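/- **Proposition (classical limit; $q$-Poisson $W$-superalgebra for $\mathfrak{sl}(2|1)$).** *Parameters.* Fix $q\in\mathbb C$ with $0<|q|<1$ and a choice of $\log q$; powers of $q$ are taken with this logarithm. For $0<\beta<1$ let $r=1/(1-\beta)$ and $x=\exp\!\big(\tfrac{(1-\beta)}{2}\log q\big)$, so that $\beta=(r-1)/r$, $q=x^{2r}$ (and $x^y=\exp(\tfrac{(1-\beta)y}{2}\log q)$). Put $[y]_p=\frac{p^y-p^{-y}}{p-p^{-1}}$, $\delta(z)=\sum_{m\in\mathbb Z}z^m$, $c(r,x)=[r]_x[r-1]_x(x-x^{-1})$, $$\Delta_1(z)=\frac{(1-x^{2r-1}z)(1-x^{-2r+1}z)}{(1-xz)(1-x^{-1}z)},$$ $$f_{i,j}(z)=\exp\Big(-\sum_{m\ge1}\frac1m\frac{[(r-1)m]_x[rm]_x[\min(i,j)m]_x[(r+1-\max(i,j))m]_x}{[m]_x[(r+1)m]_x}(x-x^{-1})^2z^m\Big).$$ *Deformed $W$-superalgebra.* Let $V=\bigoplus_{d\in\mathbb Z}V_d$ be a complex vector space with $\dim V_d<\infty$ and $V_d=0$ for $d\ll0$.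 A representation of ${\cal W}_{q,t}(\mathfrak{sl}(2|1))$ on $V$ consists of operators $T_i[m]$ $(i\ge 1, m\in\mathbb Z)$ with $T_i[m]V_d\subset V_{d-m}$ such that the currents $T_i(z)=\sum_mT_i[m]z^{-m}$, $T_0(z)=1$, satisfy for all $j\ge i\ge1$ $$f_{i,j}\big(\tfrac{z_2}{z_1}\big)T_i(z_1)T_j(z_2)-f_{j,i}\big(\tfrac{z_1}{z_2}\big)T_j(z_2)T_i(z_1)=c(r,x)\sum_{k=1}^i\prod_{l=1}^{k-1}\Delta_1(x^{2l+1})\Big(\delta\big(\tfrac{x^{-j+i-2k}z_2}{z_1}\big)f_{i-k,j+k}(x^{j-i})T_{i-k}(x^kz_1)T_{j+k}(x^{-k}z_2)-\delta\big(\tfrac{x^{j-i+2k}z_2}{z_1}\big)f_{i-k,j+k}(x^{-j+i})T_{i-k}(x^{-k}z_1)T_{j+k}(x^kz_2)\Big),$$ where the products $f_{i-k,j+k}(x^{\pm(j-i)})T_{i-k}T_{j+k}$ on the right are the values at $z_2'/z_1'=x^{\pm(j-i)}$ of the rational functions to which $f_{i-k,j+k}(z_2'/z_1')T_{i-k}(z_1')T_{j+k}(z_2')$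 (expanded in $z_2'/z_1'$) continues; these functions are required to be regular there. *Classical limit.* Suppose that for all sufficiently small $\beta>0$ operators $T_i[m]=T_i^{(\beta)}[m]$ form such a representation on the (fixed) graded space $V$, and that, as $\beta\to0$ with $q$ fixed, all matrix elements of $T_i[m]$ converge to those of an operator $T_i^{PB}[m]$ on $V$ $(i\ge0)$; put $T_i^{PB}(z)=\sum_mT_i^{PB}[m]z^{-m}$. The $q$-Poisson bracket is defined by $$\{T_i^{PB}[m],T_j^{PB}[n]\}=-\lim_{\beta\to0}\frac1{\beta\log q}\,[T_i[m],T_j[n]]$$ (limit of matrix elements). Set $$C_{i,j}(z)=\sum_{m\in\mathbb Z}\frac{[\frac12\min(i,j)m]_q\,[(\frac12\max(i,j)-1)m]_q}{[m]_q}z^m\quad(i,j\ge1),$$ where the $m=0$ term is understood as its limit value $0$. *Claim.* $T_0^{PB}(z)=1$, the operators $T_i^{PB}[m]$ commute with each other, all coefficients of products $T_i^{PB}(z_1)T_j^{PB}(z_2)$ multiplied by a formal series in $(z_2/z_1)^{\pm1}$ are finite sums on every vector, and for all $1\le i\le j$ the limits defining the bracket exist for all $m,n\in\mathbb Z$ and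 satisfy $$\{T_i^{PB}(z_1),T_j^{PB}(z_2)\}=(q-q^{-1})C_{i,j}\big(\tfrac{z_2}{z_1}\big)T_i^{PB}(z_1)T_j^{PB}(z_2)-\sum_{k=1}^i\delta\Big(\frac{q^{\frac{-j+i}2-k}z_2}{z_1}\Big)T_{i-k}^{PB}(q^{\frac k2}z_1)T_{j+k}^{PB}(q^{-\frac k2}z_2)+\sum_{k=1}^i\delta\Big(\frac{q^{\frac{j-i}2+k}z_2}{z_1}\Big)T_{i-k}^{PB}(q^{-\frac k2}z_1)T_{j+k}^{PB}(q^{\frac k2}z_2).$$ -/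

import Mathlib

open Filter Topology

/-! ## Parameters

`L` is a chosen logarithm of `q`, so `q = exp L`, and `0 < |q| < 1` means `L.re < 0`.
With `β = (r - 1) / r` we have `r = 1 / (1 - β)`, and `q = x ^ (2 r)` gives
`x = exp ((1 - β) L / 2)`.  All powers of `x` and `q` are taken with this logarithm. -/

namespace QPoissonSL21

noncomputable section

/-- The parameter `r = 1 / (1 - β)`, i.e. `β = (r - 1) / r`. -/
def rOf (β : ℝ) : ℝ := 1 / (1 - β)

/-- `q ^ y`. -/
def qPow (L : ℂ) (y : ℝ) : ℂ := Complex.exp ((y : ℂ) * L)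

/-- `x ^ y`, where `x ^ (2 r) = q`. -/
def xPow (L : ℂ) (β y : ℝ) : ℂ := Complex.exp ((y : ℂ) * ((1 - (β : ℂ)) * L / 2))

/-- `[y]_q = (q ^ y - q ^ (-y)) / (q - q ^ (-1))`. -/
def qNum (L : ℂ) (y : ℝ) : ℂ := (qPow L y - qPow L (-y)) / (qPow L 1 - qPow L (-1))

/-- `[y]_x = (x ^ y - x ^ (-y)) / (x - x ^ (-1))`. -/
def xNum (L : ℂ) (β y : ℝ) : ℂ :=
  (xPow L β y - xPow L β (-y)) / (xPow L β 1 - xPow L β (-1))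

/-! ## Structure functions of the deformed `W`-superalgebra -/

/-- `c(r, x) = [r]_x [r - 1]_x (x - x ^ (-1))`. -/
def cConst (L : ℂ) (β : ℝ) : ℂ :=
  xNum L β (rOf β) * xNum L β (rOf β - 1) * (xPow L β 1 - xPow L β (-1))

/-- `Δ₁(z) = (1 - x ^ (2r-1) z) (1 - x ^ (-2r+1) z) / ((1 - x z) (1 - x ^ (-1) z))`. -/
def Delta1 (L : ℂ) (β : ℝ) (z : ℂ) : ℂ :=
  ((1 - xPow L β (2 * rOf β - 1) * z) * (1 - xPow L β (-(2 * rOf β) + 1) * z)) /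
    ((1 - xPow L β 1 * z) * (1 - xPow L β (-1) * z))

/-- The series in the exponent of `f_{i,j}(z)`, with `s = r + 1`:
`- ∑_{m ≥ 1} (1/m) [(r-1)m]_x [rm]_x [min(i,j) m]_x [(s - max(i,j)) m]_x
    / ([m]_x [sm]_x) (x - x ^ (-1)) ^ 2 z ^ m`. -/
def fExponent (L : ℂ) (β : ℝ) (i j : ℕ) : PowerSeries ℂ :=
  PowerSeries.mk fun m =>
    if m = 0 then 0
    else -((1 / (m : ℂ)) *
      ((xNum L β ((rOf β - 1) * m) * xNum L β (rOf β * m) *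
          xNum L β ((min i j : ℕ) * m) * xNum L β ((rOf β + 1 - (max i j : ℕ)) * m)) /
        (xNum L β m * xNum L β ((rOf β + 1) * m))) *
      (xPow L β 1 - xPow L β (-1)) ^ 2)

/-- The structure function `f_{i,j}(z)`, a formal power series in `z`. -/
def fSeries (L : ℂ) (β : ℝ) (i j : ℕ) : PowerSeries ℂ :=
  (PowerSeries.exp ℂ).subst (fExponent L β i j)

/-- The coefficient of `z ^ l` in `f_{i,j}(z)`, for an integer `l`. -/
def fCoeff (L : ℂ) (β : ℝ) (i j : ℕ) (l : ℤ) : ℂ :=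
  if 0 ≤ l then PowerSeries.coeff l.toNat (fSeries L β i j) else 0

/-- The coefficient of `z ^ m` in the classical structure function `C_{i,j}(z)`:
`[min(i,j) m / 2]_q [(max(i,j) / 2 - 1) m]_q / [m]_q`.  For `m = 0` this is `0`
(also by the convention for division by zero), the limit value of the expression as `m → 0`. -/
def cCoeff (L : ℂ) (i j : ℕ) (m : ℤ) : ℂ :=
  qNum L ((min i j : ℕ) / 2 * m) * qNum L (((max i j : ℕ) / 2 - 1) * m) / qNum L m

/-! ## Currents -/

section Currents

variable {V : Type*} [AddCommGroup V] [Module ℂ V]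

/-- For a formal series `S(w) = ∑_l S_l w ^ l` and currents `X(z) = ∑_m X[m] z ^ (-m)`,
`Y(z) = ∑_n Y[n] z ^ (-n)`: the coefficient of `z₁ ^ (-m) z₂ ^ (-n)` in
`S(z₂ / z₁) X(z₁) Y(z₂)`, applied to `v`. -/
def prodCoeff (S : ℤ → ℂ) (X Y : ℤ → Module.End ℂ V) (m n : ℤ) (v : V) : V :=
  ∑ᶠ l : ℤ, S l • X (m - l) (Y (n + l) v)

/-- The current `X(a z)`. -/
def rescale (a : ℂ) (X : ℤ → Module.End ℂ V) : ℤ → Module.End ℂ V :=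
  fun m => a ^ (-m) • X m

/-- `A(w) = ∑_n A_n w ^ n` is the Laurent expansion of a `V`-valued rational function
that is regular at `w₀` and takes the value `e` there: for some polynomial `p` with
`p(w₀) ≠ 0` the product `p(w) A(w)` is a Laurent polynomial with value `p(w₀) e` at `w₀`. -/
def HasRationalValue (A : ℤ → V) (w₀ : ℂ) (e : V) : Prop :=
  ∃ p : Polynomial ℂ, p.eval w₀ ≠ 0 ∧
    (Function.support fun n : ℤ => p.sum fun k a => a • A (n - k)).Finite ∧
    ∑ᶠ n : ℤ, w₀ ^ n • (p.sum fun k a => a • A (n - k)) = p.eval w₀ • e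

/-- `f_{a,b}(z₂/z₁) T_a(z₁) T_b(z₂) v = ∑_N z₁ ^ (-N) F^N(z₂/z₁)`: the coefficient of `w ^ p`
in the Laurent series `F^N(w)`. -/
def dressedProduct (L : ℂ) (β : ℝ) (T : ℕ → ℤ → Module.End ℂ V) (a b : ℕ) (N : ℤ) (v : V) :
    ℤ → V :=
  fun p => prodCoeff (fCoeff L β a b) (T a) (T b) (N + p) (-p) v

/-- Let `H(z₁, z₂) = ∑_N z₁ ^ (-N) H^N(z₂ / z₁)`.  The delta function in
`δ(A z₂ / z₁) H(t z₁, t ^ (-1) z₂)` sets `z₂ / z₁ = A ^ (-1)`, so the expression equals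
`δ(A z₂ / z₁) ∑_N (t z₁) ^ (-N) H^N(w₀)` with `w₀ = A ^ (-1) t ^ (-2)`.  If `e = H^(m+n)(w₀)`,
this is its coefficient of `z₁ ^ (-m) z₂ ^ (-n)`. -/
def deltaCoeff (A t : ℂ) (m n : ℤ) (e : V) : V :=
  (A ^ (-n) * t ^ (-(m + n))) • e

/-- `T i m = T_i[m]` are operators on the graded space `V` of degree `-m` which satisfy the
defining relations of the deformed `W`-superalgebra of `sl(2|1)` at the parameters `r`, `x`:
for `j ≥ i ≥ 1`
`f_{i,j}(z₂/z₁) T_i(z₁) T_j(z₂) - f_{j,i}(z₁/z₂) T_j(z₂) T_i(z₁)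
  = c(r,x) ∑_{k=1}^{i} ∏_{l=1}^{k-1} Δ₁(x^(2l+1)) *
    ( δ(x^(-j+i-2k) z₂/z₁) f_{i-k,j+k}(x^(j-i)) T_{i-k}(x^k z₁) T_{j+k}(x^(-k) z₂)
    - δ(x^(j-i+2k) z₂/z₁) f_{i-k,j+k}(x^(-j+i)) T_{i-k}(x^(-k) z₁) T_{j+k}(x^k z₂) )`
with `T_0(z) = 1`.  The products `f_{i-k,j+k}(w) T_{i-k} T_{j+k}` on the right at
`w = x^(±(j-i))` are the values of the rational functions to which the products
`f_{i-k,j+k}(z₂/z₁) T_{i-k}(z₁) T_{j+k}(z₂)` continue. -/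
structure IsWRepresentation (L : ℂ) (β : ℝ) (𝒱 : ℤ → Submodule ℂ V)
    (T : ℕ → ℤ → Module.End ℂ V) : Prop where
  degree : ∀ (i : ℕ) (m d : ℤ) (v : V), v ∈ 𝒱 d → T i m v ∈ 𝒱 (d - m)
  zero : ∀ m : ℤ, T 0 m = if m = 0 then 1 else 0
  quadratic : ∀ i j : ℕ, 1 ≤ i → i ≤ j → ∀ (m n : ℤ) (v : V), ∃ e₁ e₂ : ℕ → V,
    (∀ k ∈ Finset.Icc 1 i,
      HasRationalValue (dressedProduct L β T (i - k) (j + k) (m + n) v)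
        (xPow L β ((j : ℝ) - i)) (e₁ k) ∧
      HasRationalValue (dressedProduct L β T (i - k) (j + k) (m + n) v)
        (xPow L β (-(j : ℝ) + i)) (e₂ k)) ∧
    prodCoeff (fCoeff L β i j) (T i) (T j) m n v
        - prodCoeff (fCoeff L β j i) (T j) (T i) n m v =
      cConst L β • ∑ k ∈ Finset.Icc 1 i,
        (∏ l ∈ Finset.Icc 1 (k - 1), Delta1 L β (xPow L β (2 * l + 1))) •
          (deltaCoeff (xPow L β (-(j : ℝ) + i - 2 * k)) (xPow L β k) m n (e₁ k)
            - deltaCoeff (xPow L β ((j : ℝ) - i + 2 * k)) (xPow L β (-k)) m n (e₂ k))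

/-- All matrix elements of `A β` converge to those of `A₀` as `β → 0`, `β > 0`. -/
def MatrixTendsto (A : ℝ → V → V) (A₀ : V → V) : Prop :=
  ∀ (φ : Module.Dual ℂ V) (v : V), Tendsto (fun β => φ (A β v)) (𝓝[>] 0) (𝓝 (φ (A₀ v)))

/-- `{T_i^PB[m], T_j^PB[n]} = P`, where the `q`-Poisson bracket is
`- lim_{β → 0} (β log q)⁻¹ [T_i[m], T_j[n]]`. -/
def HasPoissonBracket (L : ℂ) (T : ℝ → ℕ → ℤ → Module.End ℂ V) (i j : ℕ) (m n : ℤ)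
    (P : V → V) : Prop :=
  MatrixTendsto
    (fun β v => -((1 / ((β : ℂ) * L)) • (T β i m (T β j n v) - T β j n (T β i m v)))) P

end Currents

end

end QPoissonSL21

/-! Both ingredients of the quadratic relation are known to first order in `β`: `c(r, x) = β log q +
o(β)`, and the coefficient of `z ^ l`, `l ≥ 1`, in `f_{i,j}` is `β log q (q - q⁻¹)` times that of
`C_{i,j}`, up to `o(β)`, while the constant term is exactly `1` (`tendsto_cConst_div`,
`tendsto_fCoeff_div`). The constant terms contribute the commutator. Dividing by `β log q` leaves
the positive halves of `C_{i,j}` and `C_{j,i}` and the delta terms. Since the coefficients of `C`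
are odd in the mode and the limit operators commute, the two halves form one two-sided series
(`prodCoeff_cCoeff`).

The difficulty lies in the delta terms. They contain values of rational functions, which depend on
infinitely many Laurent coefficients, so convergence of matrix elements does not by itself make
these values converge. `valuesConverge` settles this by strong induction on the smaller index `i`.
On a fixed vector the product of `T_i` and `T_j` has no coefficients far to the left. Far to the
right the opposite product vanishes, so there the relation gives the coefficients exactly: `c(r, x)`
times geometric sequences whose weights are values for the smaller indices `i - k`. The function is
therefore a Laurent polynomial, with exponent range independent of `β`, plus geometric tails. The
tails have bounded values away from their poles and are killed by `c(r, x) → 0`. Evaluation at all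
points `x ^ s` with `|s| ≤ j - i` is carried along because the delta terms of `T_i` and `T_j`
evaluate the pair `(i - k, j + k)` inside its own range.

Commutativity of the limit operators comes from the undivided limit of the same relation
(`apply_comm_of_valuesConverge`). -/

namespace QPoissonSL21

noncomputable section

/-! ### Values of vector-valued rational functions given by Laurent expansions. -/

section RationalValue

variable {V : Type*} [AddCommGroup V] [Module ℂ V]

/-- Multiplication of a formal series `∑ A_n w ^ n` by `w`. -/
def shift : Module.End ℂ (ℤ → V) where
  toFun A n := A (n - 1)
  map_add' _ _ := rfl
  map_smul' _ _ := rfl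

/-- Multiplication of a formal series by a polynomial. -/
def polyMul (p : Polynomial ℂ) : Module.End ℂ (ℤ → V) := Polynomial.aeval shift p

lemma shift_pow_apply (k : ℕ) (A : ℤ → V) (n : ℤ) : (shift ^ k) A n = A (n - k) := by
  induction k generalizing n with
  | zero => simp
  | succ k ih =>
    rw [pow_succ', Module.End.mul_apply]
    change (shift ^ k) A (n - 1) = _
    rw [ih]
    congr 1
    push_cast
    ring

lemma polyMul_apply (p : Polynomial ℂ) (A : ℤ → V) (n : ℤ) :
    polyMul p A n = p.sum fun k a => a • A (n - k) := by
  rw [polyMul, Polynomial.aeval_eq_sum_range, Polynomial.sum_over_range _ (by simp)]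
  simp [LinearMap.sum_apply, Finset.sum_apply, shift_pow_apply]

lemma polyMul_mul (p p' : Polynomial ℂ) (A : ℤ → V) :
    polyMul (p * p') A = polyMul p (polyMul p' A) := by
  simp [polyMul]

/-- The value at `w` of a Laurent polynomial. -/
def evalAt (w : ℂ) (A : ℤ → V) : V := ∑ᶠ n : ℤ, w ^ n • A n

lemma hasRationalValue_iff {A : ℤ → V} {w : ℂ} {e : V} :
    HasRationalValue A w e ↔ ∃ p : Polynomial ℂ, p.eval w ≠ 0 ∧
      (Function.support (polyMul p A)).Finite ∧ evalAt w (polyMul p A) = p.eval w • e := by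
  have h : ∀ p : Polynomial ℂ, polyMul p A = fun n => p.sum fun k a => a • A (n - k) :=
    fun p => funext fun n => polyMul_apply p A n
  simp only [h]
  rfl

lemma evalAt_support_finite {A : ℤ → V} (hA : (Function.support A).Finite) (w : ℂ) :
    (Function.support fun n : ℤ => w ^ n • A n).Finite :=
  hA.subset fun n hn h0 => hn (by simp [h0])

lemma evalAt_add {A B : ℤ → V} (hA : (Function.support A).Finite)
    (hB : (Function.support B).Finite) (w : ℂ) : evalAt w (A + B) = evalAt w A + evalAt w B := by
  unfold evalAt
  rw [← finsum_add_distrib (evalAt_support_finite hA w) (evalAt_support_finite hB w)]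
  simp

lemma evalAt_smul (c : ℂ) (A : ℤ → V) (w : ℂ) : evalAt w (c • A) = c • evalAt w A := by
  unfold evalAt
  rw [smul_finsum]
  simp [smul_comm c]

lemma shift_support {A : ℤ → V} (hA : (Function.support A).Finite) :
    (Function.support (shift A)).Finite := by
  refine (hA.image (· + 1)).subset fun n hn => ⟨n - 1, hn, by simp⟩

/-- At `w = 0` this fails in passing from exponent `-1` to `0`, because `0 ^ (-1) = 0` but `0 ^ 0 =
1`. -/
lemma evalAt_shift (A : ℤ → V) {w : ℂ} (hw : w ≠ 0) :
    evalAt w (shift A) = w • evalAt w A := by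
  unfold evalAt
  rw [smul_finsum, ← finsum_comp_equiv (Equiv.addRight (1 : ℤ))]
  refine finsum_congr fun n => ?_
  change w ^ (n + 1) • A (n + 1 - 1) = _
  rw [zpow_add_one₀ hw, mul_comm, mul_smul, add_sub_cancel_right]

lemma polyMul_support {A : ℤ → V} (hA : (Function.support A).Finite) (p : Polynomial ℂ) :
    (Function.support (polyMul p A)).Finite ∧
      ∀ w : ℂ, w ≠ 0 → evalAt w (polyMul p A) = p.eval w • evalAt w A := by
  induction p using Polynomial.induction_on with
  | C a =>
    have h : polyMul (Polynomial.C a) A = a • A := by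
      simp [polyMul, Algebra.algebraMap_eq_smul_one]
    rw [h]
    exact ⟨hA.subset (Function.support_const_smul_subset a A), fun w _ => by simp [evalAt_smul]⟩
  | add p p' hp hp' =>
    have h : polyMul (p + p') A = polyMul p A + polyMul p' A := by simp [polyMul]
    rw [h]
    refine ⟨(hp.1.union hp'.1).subset (Function.support_add _ _), fun w hw => ?_⟩
    rw [evalAt_add hp.1 hp'.1, hp.2 w hw, hp'.2 w hw, Polynomial.eval_add, add_smul]
  | monomial n a h =>
    have h' : polyMul (Polynomial.C a * Polynomial.X ^ (n + 1)) A
        = shift (polyMul (Polynomial.C a * Polynomial.X ^ n) A) := by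
      have : (Polynomial.C a * Polynomial.X ^ (n + 1) : Polynomial ℂ)
        = Polynomial.X * (Polynomial.C a * Polynomial.X ^ n) := by ring
      rw [this, polyMul_mul]
      simp [polyMul]
    rw [h']
    refine ⟨shift_support h.1, fun w hw => ?_⟩
    rw [evalAt_shift _ hw, h.2 w hw, smul_smul]
    congr 1
    simp
    ring

/-- Cross-multiplication: clearing both denominators `p` and `p'` in either order gives the same
Laurent polynomial, and neither denominator vanishes at `w`. -/
lemma HasRationalValue.unique {A : ℤ → V} {w : ℂ} {e e' : V} (hw : w ≠ 0)
    (h : HasRationalValue A w e) (h' : HasRationalValue A w e') : e = e' := by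
  obtain ⟨p, hp, hf, he⟩ := hasRationalValue_iff.1 h
  obtain ⟨p', hp', hf', he'⟩ := hasRationalValue_iff.1 h'
  have h1 := (polyMul_support hf p').2 w hw
  have h2 := (polyMul_support hf' p).2 w hw
  rw [← polyMul_mul, mul_comm, polyMul_mul, h2, he, he', smul_smul, smul_smul, mul_comm] at h1
  exact (smul_right_injective V (mul_ne_zero hp' hp) h1).symm

lemma HasRationalValue.add {A B : ℤ → V} {w : ℂ} {e e' : V} (hw : w ≠ 0)
    (h : HasRationalValue A w e) (h' : HasRationalValue B w e') :
    HasRationalValue (A + B) w (e + e') := by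
  obtain ⟨p, hp, hf, he⟩ := hasRationalValue_iff.1 h
  obtain ⟨p', hp', hf', he'⟩ := hasRationalValue_iff.1 h'
  have h1 := polyMul_support hf p'
  have h2 := polyMul_support hf' p
  rw [← polyMul_mul, mul_comm] at h1
  rw [← polyMul_mul] at h2
  refine hasRationalValue_iff.2 ⟨p * p', by simp [hp, hp'], ?_, ?_⟩
  · rw [map_add]
    exact (h1.1.union h2.1).subset (Function.support_add _ _)
  · rw [map_add, evalAt_add h1.1 h2.1, h1.2 w hw, h2.2 w hw, he, he', smul_smul, smul_smul,
      Polynomial.eval_mul, smul_add, mul_comm (p'.eval w)]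

lemma HasRationalValue.smul {A : ℤ → V} {w : ℂ} {e : V} (c : ℂ)
    (h : HasRationalValue A w e) : HasRationalValue (c • A) w (c • e) := by
  obtain ⟨p, hp, hf, he⟩ := hasRationalValue_iff.1 h
  refine hasRationalValue_iff.2 ⟨p, hp, ?_, ?_⟩
  · rw [map_smul]
    exact hf.subset (Function.support_const_smul_subset c _)
  · rw [map_smul, evalAt_smul, he, smul_comm]

lemma HasRationalValue.of_finite {A : ℤ → V} (hA : (Function.support A).Finite) (w : ℂ) :
    HasRationalValue A w (evalAt w A) :=
  hasRationalValue_iff.2 ⟨1, by simp, by simpa [polyMul] using hA, by simp [polyMul]⟩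

lemma HasRationalValue.sum {ι : Type*} (s : Finset ι) {A : ι → ℤ → V} {w : ℂ} {e : ι → V}
    (hw : w ≠ 0) (h : ∀ i ∈ s, HasRationalValue (A i) w (e i)) :
    HasRationalValue (∑ i ∈ s, A i) w (∑ i ∈ s, e i) := by
  classical
  induction s using Finset.induction_on with
  | empty =>
    have := HasRationalValue.of_finite (A := (0 : ℤ → V)) (by simp) w
    simpa [evalAt] using this
  | insert a s ha ih =>
    rw [Finset.sum_insert ha, Finset.sum_insert ha]
    exact (h a (by simp)).add hw (ih fun i hi => h i (by simp [hi]))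

/-- The expansion of a truncated geometric series. -/
lemma HasRationalValue.geometric (P : ℤ) {a w : ℂ} (ha : a ≠ 0) (haw : a * w ≠ 1)
    (u : V) :
    HasRationalValue (fun n : ℤ => if P ≤ n then a ^ n • u else 0) w
      (((a * w) ^ P / (1 - a * w)) • u) := by
  have hne : 1 - a * w ≠ 0 := sub_ne_zero.2 haw.symm
  -- The denominator `1 - a w` telescopes the series to its first term.
  have key : polyMul (1 - Polynomial.C a * Polynomial.X)
      (fun n : ℤ => if P ≤ n then a ^ n • u else 0) = fun n => if n = P then a ^ P • u else 0 := by
    funext n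
    have : polyMul (1 - Polynomial.C a * Polynomial.X)
      (fun n : ℤ => if P ≤ n then a ^ n • u else 0) n =
      (if P ≤ n then a ^ n • u else 0) - a • (if P ≤ n - 1 then a ^ (n - 1) • u else 0) := by
      simp only [polyMul, map_sub, map_one, map_mul, Polynomial.aeval_C, Polynomial.aeval_X,
        Algebra.algebraMap_eq_smul_one]
      rfl
    rw [this]
    rcases lt_trichotomy n P with h | h | h
    · simp [not_le.2 h, h.ne, show ¬ P ≤ n - 1 by omega]
    · subst h
      simp
    · simp only [h.le, h.ne', show P ≤ n - 1 by omega, if_true, if_false]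
      rw [smul_smul, ← zpow_one_add₀ ha, add_sub_cancel, sub_self]
  refine hasRationalValue_iff.2 ⟨1 - Polynomial.C a * Polynomial.X, by simpa using hne, ?_, ?_⟩
  · rw [key]
    exact (Set.finite_singleton P).subset fun n hn => by
      by_contra h
      exact hn (if_neg h)
  · rw [key, evalAt, finsum_eq_single _ P (fun n hn => by simp [hn])]
    simp only [if_true, smul_smul]
    congr 1
    simp
    field_simp
    rw [mul_zpow, mul_comm]

/-- The value at `w` of a rational function, given by its Laurent expansion `A`. -/
def ratVal (A : ℤ → V) (w : ℂ) : V :=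
  open Classical in if h : ∃ e, HasRationalValue A w e then h.choose else 0

lemma HasRationalValue.ratVal_eq {A : ℤ → V} {w : ℂ} {e : V} (hw : w ≠ 0)
    (h : HasRationalValue A w e) : ratVal A w = e := by
  have h' : ∃ e, HasRationalValue A w e := ⟨e, h⟩
  rw [ratVal, dif_pos h']
  exact h'.choose_spec.unique hw h

end RationalValue

/-! ### Powers of `q` and `x`, and the limits of `c(r, x)` and `Δ₁`. -/

lemma qPow_add (L : ℂ) (y z : ℝ) : qPow L (y + z) = qPow L y * qPow L z := by
  simp [qPow, add_mul, Complex.exp_add]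

lemma qPow_ne_zero (L : ℂ) (y : ℝ) : qPow L y ≠ 0 := Complex.exp_ne_zero _

lemma qPow_zpow (L : ℂ) (y : ℝ) (n : ℤ) : qPow L y ^ n = qPow L (n * y) := by
  rw [qPow, qPow, ← Complex.exp_int_mul]
  congr 1
  push_cast
  ring

lemma xPow_eq_qPow (L : ℂ) (β y : ℝ) : xPow L β y = qPow L (y * (1 - β) / 2) := by
  rw [xPow, qPow]
  congr 1
  push_cast
  ring

lemma xPow_ne_zero (L : ℂ) (β y : ℝ) : xPow L β y ≠ 0 := Complex.exp_ne_zero _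

lemma xPow_mul (L : ℂ) (β y z : ℝ) : xPow L β y * xPow L β z = xPow L β (y + z) := by
  rw [xPow_eq_qPow, xPow_eq_qPow, xPow_eq_qPow, ← qPow_add]
  congr 1
  ring

lemma qPow_ne_one {L : ℂ} (hL : L.re < 0) {y : ℝ} (hy : y ≠ 0) : qPow L y ≠ 1 := by
  intro h
  have := congrArg norm h
  rw [qPow, Complex.norm_exp, norm_one, Real.exp_eq_one_iff] at this
  simp at this
  exact this.elim hy hL.ne

lemma xPow_ne_one {L : ℂ} (hL : L.re < 0) {β : ℝ} (hβ : β < 1) {y : ℝ} (hy : y ≠ 0) :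
    xPow L β y ≠ 1 := by
  rw [xPow_eq_qPow]
  exact qPow_ne_one hL (by
    have : 1 - β ≠ 0 := by linarith
    positivity)

/-- `q ^ y - q ^ (-y)`. -/
def qDiff (L : ℂ) (y : ℝ) : ℂ := qPow L y - qPow L (-y)

lemma qDiff_neg (L : ℂ) (y : ℝ) : qDiff L (-y) = -qDiff L y := by simp [qDiff]

lemma qDiff_ne_zero {L : ℂ} (hL : L.re < 0) {y : ℝ} (hy : y ≠ 0) : qDiff L y ≠ 0 := by
  intro h
  have h1 : qPow L (y + y) = 1 := by
    rw [qPow_add]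
    nth_rewrite 1 [sub_eq_zero.1 h]
    rw [← qPow_add]
    simp [qPow]
  exact qPow_ne_one hL (by simpa using hy) h1

lemma xDiff_eq (L : ℂ) (β y : ℝ) :
    xPow L β y - xPow L β (-y) = qDiff L (y * (1 - β) / 2) := by
  rw [xPow_eq_qPow, xPow_eq_qPow, qDiff]
  congr 2
  ring

lemma xNum_eq (L : ℂ) (β y : ℝ) :
    xNum L β y = qDiff L (y * (1 - β) / 2) / qDiff L ((1 - β) / 2) := by
  rw [xNum, xDiff_eq, xDiff_eq, one_mul]

lemma continuous_qPow (L : ℂ) : Continuous (qPow L) := by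
  unfold qPow
  fun_prop

lemma continuous_qDiff (L : ℂ) : Continuous (qDiff L) := by
  unfold qDiff
  have := continuous_qPow L
  fun_prop

lemma tendsto_of_continuousAt {f : ℝ → ℂ} (hf : ContinuousAt f 0) {a : ℂ} (ha : f 0 = a) :
    Tendsto f (𝓝[>] 0) (𝓝 a) :=
  ha ▸ hf.tendsto.mono_left nhdsWithin_le_nhds

lemma tendsto_xPow (L : ℂ) (y : ℝ) :
    Tendsto (fun β => xPow L β y) (𝓝[>] 0) (𝓝 (qPow L (y / 2))) := by
  simp_rw [xPow_eq_qPow]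
  have := continuous_qPow L
  exact tendsto_of_continuousAt (by fun_prop) (by simp)

lemma eventually_Ioo : ∀ᶠ β : ℝ in 𝓝[>] 0, 0 < β ∧ β < 1 :=
  Ioo_mem_nhdsGT one_pos

lemma hasDerivAt_qDiff (L : ℂ) (c : ℝ) :
    HasDerivAt (fun β : ℝ => qDiff L (c * β)) (2 * c * L) 0 := by
  have h1 : ∀ c : ℝ, HasDerivAt (fun β : ℝ => qPow L (c * β)) (c * L) 0 := fun c => by
    have : HasDerivAt (fun β : ℝ => c * β) (c * 1) 0 := (hasDerivAt_id _).const_mul c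
    simpa [qPow] using ((this.ofReal_comp).mul_const L).cexp
  refine ((h1 c).sub (h1 (-c))).congr_deriv (by push_cast; ring) |>.congr_of_eventuallyEq ?_
  exact Filter.Eventually.of_forall fun β => by simp [qDiff]

lemma tendsto_qDiff_div (L : ℂ) (c : ℝ) :
    Tendsto (fun β : ℝ => qDiff L (c * β) / β) (𝓝[>] 0) (𝓝 (2 * c * L)) := by
  have h := (hasDerivAt_iff_tendsto_slope.1 (hasDerivAt_qDiff L c)).mono_left
    (nhdsWithin_mono 0 (fun x (hx : 0 < x) => hx.ne'))
  refine h.congr fun β => ?_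
  simp [slope, qDiff, div_eq_inv_mul]

/-- In terms of `q`, the factor `[r]_x` has numerator `qDiff L (1 / 2)`, independent of `β`, and `[r
- 1]_x` has numerator `qDiff L (β / 2)`. The latter is the only vanishing factor and has derivative
`L` at `0`. -/
lemma tendsto_cConst_div {L : ℂ} (hL : L.re < 0) :
    Tendsto (fun β : ℝ => cConst L β / β) (𝓝[>] 0) (𝓝 L) := by
  have h1 := tendsto_qDiff_div L (1 / 2)
  have h2 : Tendsto (fun β : ℝ => qDiff L (1 / 2) / qDiff L ((1 - β) / 2)) (𝓝[>] 0) (𝓝 1) := by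
    have := continuous_qDiff L
    refine tendsto_of_continuousAt ?_ ?_
    · refine ContinuousAt.div (by fun_prop) (by fun_prop) ?_
      exact qDiff_ne_zero hL (by norm_num)
    · simp only [sub_zero]
      exact div_self (qDiff_ne_zero hL (by norm_num))
  have h3 := h1.mul h2
  have h4 : 2 * ((1 / 2 : ℝ) : ℂ) * L * 1 = L := by push_cast; ring
  rw [h4] at h3
  refine h3.congr' ?_
  filter_upwards [eventually_Ioo] with β hβ
  have hr : 1 - β ≠ 0 := by linarith
  have hx : qDiff L ((1 - β) / 2) ≠ 0 := qDiff_ne_zero hL (by positivity)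
  rw [cConst, xNum_eq, xNum_eq, xDiff_eq, rOf]
  rw [show 1 / (1 - β) * (1 - β) / 2 = 1 / 2 by field_simp,
    show (1 / (1 - β) - 1) * (1 - β) / 2 = 1 / 2 * β by field_simp; ring, one_mul]
  field_simp

lemma tendsto_cConst {L : ℂ} (hL : L.re < 0) :
    Tendsto (cConst L) (𝓝[>] 0) (𝓝 0) := by
  have h : Tendsto (fun β : ℝ => (β : ℂ)) (𝓝[>] 0) (𝓝 0) :=
    tendsto_of_continuousAt (by fun_prop) (by simp)
  have := (tendsto_cConst_div hL).mul h
  rw [mul_zero] at this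
  refine this.congr' ?_
  filter_upwards [eventually_Ioo] with β hβ
  have : (β : ℂ) ≠ 0 := by exact_mod_cast hβ.1.ne'
  field_simp

/-- At `β = 0` one has `r = 1`, and numerator and denominator of `Δ₁` coincide. The denominator is
`(1 - q ^ (l + 1)) (1 - q ^ l)`, nonzero for `l ≥ 1`. -/
lemma tendsto_Delta1 {L : ℂ} (hL : L.re < 0) {l : ℕ} (hl : 1 ≤ l) :
    Tendsto (fun β => Delta1 L β (xPow L β (2 * l + 1))) (𝓝[>] 0) (𝓝 1) := by
  have hl' : (1 : ℝ) ≤ l := by exact_mod_cast hl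
  have hr : ContinuousAt rOf 0 := by
    unfold rOf
    exact ContinuousAt.div (by fun_prop) (by fun_prop) (by norm_num)
  have hq := continuous_qPow L
  have hd : (1 - qPow L (1 / 2) * qPow L ((2 * l + 1) / 2)) *
      (1 - qPow L (-1 / 2) * qPow L ((2 * l + 1) / 2)) ≠ 0 := by
    rw [← qPow_add, ← qPow_add]
    refine mul_ne_zero (sub_ne_zero.2 (qPow_ne_one hL ?_).symm)
      (sub_ne_zero.2 (qPow_ne_one hL ?_).symm) <;> linarith
  unfold Delta1
  simp_rw [xPow_eq_qPow]
  refine tendsto_of_continuousAt ?_ ?_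
  · refine ContinuousAt.div (by fun_prop) (by fun_prop) ?_
    simpa using hd
  · have h0 : rOf 0 = 1 := by simp [rOf]
    rw [h0]
    have e1 : ((2 * 1 - 1) * (1 - 0) / 2 : ℝ) = 1 / 2 := by norm_num
    have e2 : ((-(2 * 1) + 1) * (1 - 0) / 2 : ℝ) = -1 / 2 := by norm_num
    have e3 : (1 * (1 - 0) / 2 : ℝ) = 1 / 2 := by norm_num
    have e4 : (-1 * (1 - 0) / 2 : ℝ) = -1 / 2 := by norm_num
    rw [e1, e2, e3, e4, sub_zero, mul_one]
    exact div_self hd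

/-! ### First-order expansion of the structure functions. -/

lemma cCoeff_eq {L : ℂ} (hL : L.re < 0) (i j : ℕ) (m : ℤ) :
    (qPow L 1 - qPow L (-1)) * cCoeff L i j m =
      qDiff L ((min i j : ℕ) / 2 * m) * qDiff L (((max i j : ℕ) / 2 - 1) * m) / qDiff L m := by
  have h1 : qDiff L 1 ≠ 0 := qDiff_ne_zero hL one_ne_zero
  change qDiff L 1 * (qDiff L _ / qDiff L 1 * (qDiff L _ / qDiff L 1) / (qDiff L _ / qDiff L 1)) = _
  by_cases hm : m = 0
  · subst hm
    simp [qDiff]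
  · have h2 : qDiff L m ≠ 0 := qDiff_ne_zero hL (by exact_mod_cast hm)
    field_simp

lemma cCoeff_zero (L : ℂ) (i j : ℕ) : cCoeff L i j 0 = 0 := by simp [cCoeff, qNum]

lemma cCoeff_neg (L : ℂ) (i j : ℕ) (m : ℤ) : cCoeff L i j (-m) = -cCoeff L i j m := by
  have h : ∀ y, qNum L (-y) = -qNum L y := fun y => by
    change qDiff L (-y) / _ = -(qDiff L y / _)
    rw [qDiff_neg, neg_div]
  simp only [cCoeff, Int.cast_neg, mul_neg, h]
  rw [← sub_eq_zero]
  ring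

lemma cCoeff_comm (L : ℂ) (i j : ℕ) (m : ℤ) : cCoeff L j i m = cCoeff L i j m := by
  rw [cCoeff, cCoeff, min_comm, max_comm]

/-- Only `[(r - 1) m]_x` vanishes as `β → 0`; its derivative supplies `m L`, which cancels the `1 /
m`. In the limit `[rm]_x` cancels `[m]_x`, and the overall minus sign is absorbed by `[(r + 1 -
max(i,j)) m]_x`, whose argument tends to the negative of the one in `C_{i,j}`. -/
lemma tendsto_fExponent_div {L : ℂ} (hL : L.re < 0) (i j m : ℕ) :
    Tendsto (fun β : ℝ => PowerSeries.coeff m (fExponent L β i j) / β) (𝓝[>] 0)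
      (𝓝 (L * ((qPow L 1 - qPow L (-1)) * cCoeff L i j m))) := by
  by_cases hm : m = 0
  · subst hm
    simp [fExponent, cCoeff_zero]
  have hm' : (m : ℝ) ≠ 0 := by exact_mod_cast hm
  have hmC : (m : ℂ) ≠ 0 := by exact_mod_cast hm
  have hq := continuous_qDiff L
  have hA := tendsto_qDiff_div L (m / 2)
  have h2 : qDiff L m ≠ 0 := qDiff_ne_zero hL hm'
  have h3 : qDiff L (m / 2) ≠ 0 := qDiff_ne_zero hL (by positivity)
  have hB : Tendsto (fun β : ℝ => -(1 / (m : ℂ)) * (qDiff L (m / 2) *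
      qDiff L ((min i j : ℕ) * m * (1 - β) / 2) *
      qDiff L ((2 - β - (max i j : ℕ) * (1 - β)) * m / 2) /
        (qDiff L (m * (1 - β) / 2) * qDiff L ((2 - β) * m / 2)))) (𝓝[>] 0)
      (𝓝 (-(1 / (m : ℂ)) * (qDiff L ((min i j : ℕ) / 2 * m) *
        -qDiff L (((max i j : ℕ) / 2 - 1) * m) / qDiff L m))) := by
    refine tendsto_of_continuousAt ?_ ?_
    · refine ContinuousAt.mul (by fun_prop) (ContinuousAt.div (by fun_prop) (by fun_prop) ?_)
      refine mul_ne_zero ?_ ?_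
      · simpa using h3
      · simpa using h2
    · rw [← qDiff_neg]
      have e1 : ((min i j : ℕ) * m * (1 - 0) / 2 : ℝ) = (min i j : ℕ) / 2 * m := by ring
      have e2 : ((2 - 0 - (max i j : ℕ) * (1 - 0)) * m / 2 : ℝ)
        = -(((max i j : ℕ) / 2 - 1) * m) := by ring
      have e3 : (m * (1 - 0) / 2 : ℝ) = m / 2 := by ring
      have e4 : ((2 - 0) * m / 2 : ℝ) = m := by ring
      rw [e1, e2, e3, e4]
      field_simp
  have hAB := hA.mul hB
  have e : 2 * ((m / 2 : ℝ) : ℂ) * L * (-(1 / (m : ℂ)) * (qDiff L ((min i j : ℕ) / 2 * m) *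
        -qDiff L (((max i j : ℕ) / 2 - 1) * m) / qDiff L m)) =
      L * ((qPow L 1 - qPow L (-1)) * cCoeff L i j m) := by
    rw [cCoeff_eq hL]
    push_cast
    field_simp
  rw [e] at hAB
  refine hAB.congr' ?_
  filter_upwards [eventually_Ioo] with β hβ
  have hr : 1 - β ≠ 0 := by linarith
  have hb : (β : ℂ) ≠ 0 := by exact_mod_cast hβ.1.ne'
  have hx : qDiff L ((1 - β) / 2) ≠ 0 := qDiff_ne_zero hL (by positivity)
  have h4 : qDiff L (m * (1 - β) / 2) ≠ 0 := qDiff_ne_zero hL (by positivity)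
  have h5 : qDiff L ((2 - β) * m / 2) ≠ 0 := qDiff_ne_zero hL (by
    have : 2 - β ≠ 0 := by linarith
    positivity)
  simp only [fExponent, PowerSeries.coeff_mk, if_neg hm, xNum_eq, xDiff_eq, rOf]
  rw [show (1 / (1 - β) - 1) * m * (1 - β) / 2 = m / 2 * β by field_simp; ring,
    show 1 / (1 - β) * m * (1 - β) / 2 = m / 2 by field_simp,
    show (1 / (1 - β) + 1 - (max i j : ℕ)) * m * (1 - β) / 2
      = (2 - β - (max i j : ℕ) * (1 - β)) * m / 2 by field_simp; ring,
    show (1 / (1 - β) + 1) * m * (1 - β) / 2 = (2 - β) * m / 2 by field_simp; ring, one_mul]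
  field_simp

lemma constantCoeff_fExponent (L : ℂ) (β : ℝ) (i j : ℕ) :
    PowerSeries.constantCoeff (fExponent L β i j) = 0 := by
  rw [← PowerSeries.coeff_zero_eq_constantCoeff_apply]
  simp [fExponent]

lemma coeff_zero_fSeries (L : ℂ) (β : ℝ) (i j : ℕ) :
    PowerSeries.coeff 0 (fSeries L β i j) = 1 := by
  have hs := PowerSeries.HasSubst.of_constantCoeff_zero' (constantCoeff_fExponent L β i j)
  rw [fSeries, PowerSeries.coeff_subst' hs, finsum_eq_single _ 0]
  · simp
  · intro n hn
    simp [constantCoeff_fExponent, hn]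

/-- The differential equation `f' = f g'` for `f = exp g`, read coefficientwise. It is a recursion
that avoids expanding the exponential. -/
lemma coeff_succ_fSeries (L : ℂ) (β : ℝ) (i j n : ℕ) :
    PowerSeries.coeff (n + 1) (fSeries L β i j) * (n + 1) =
      ∑ p ∈ Finset.HasAntidiagonal.antidiagonal n, PowerSeries.coeff p.1 (fSeries L β i j) *
        (PowerSeries.coeff (p.2 + 1) (fExponent L β i j) * (p.2 + 1)) := by
  have hs := PowerSeries.HasSubst.of_constantCoeff_zero' (constantCoeff_fExponent L β i j)
  have h := PowerSeries.derivative_subst (f := PowerSeries.exp ℂ) hs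
  rw [PowerSeries.derivative_exp] at h
  have h' := congrArg (PowerSeries.coeff n) h
  rw [PowerSeries.coeff_derivative, PowerSeries.coeff_mul] at h'
  simpa [PowerSeries.coeff_derivative, fSeries] using h'

lemma tendsto_fSeries_div {L : ℂ} (hL : L.re < 0) (i j n : ℕ) (hn : n ≠ 0) :
    Tendsto (fun β : ℝ => PowerSeries.coeff n (fSeries L β i j) / β) (𝓝[>] 0)
      (𝓝 (L * ((qPow L 1 - qPow L (-1)) * cCoeff L i j n))) := by
  induction n using Nat.strong_induction_on with
  | _ n ih =>
  obtain ⟨n, rfl⟩ := Nat.exists_eq_succ_of_ne_zero hn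
  have hn1 : (n : ℂ) + 1 ≠ 0 := by exact_mod_cast n.succ_ne_zero
  have h0 : Tendsto (fun β : ℝ => (β : ℂ)) (𝓝[>] 0) (𝓝 0) :=
    tendsto_of_continuousAt (by fun_prop) (by simp)
  have key : ∀ p ∈ Finset.HasAntidiagonal.antidiagonal n, Tendsto (fun β : ℝ =>
      PowerSeries.coeff p.1 (fSeries L β i j) *
        (PowerSeries.coeff (p.2 + 1) (fExponent L β i j) / β * (p.2 + 1))) (𝓝[>] 0)
      (𝓝 ((if p.1 = 0 then 1 else 0) *
        (L * ((qPow L 1 - qPow L (-1)) * cCoeff L i j (p.2 + 1 : ℕ)) * (p.2 + 1)))) := by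
    intro p hp
    refine Tendsto.mul ?_ ((tendsto_fExponent_div hL i j (p.2 + 1)).mul_const _)
    by_cases hp1 : p.1 = 0
    · simp [hp1, -PowerSeries.coeff_zero_eq_constantCoeff, coeff_zero_fSeries]
    · have hlt : p.1 < n + 1 := by
        have := Finset.HasAntidiagonal.mem_antidiagonal.1 hp
        omega
      have h := (ih p.1 hlt hp1).mul h0
      rw [if_neg hp1]
      rw [mul_zero] at h
      refine h.congr' ?_
      filter_upwards [eventually_Ioo] with β hβ
      have hb : (β : ℂ) ≠ 0 := by exact_mod_cast hβ.1.ne'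
      field_simp
  have hsum := (tendsto_finsetSum _ key).div_const ((n : ℂ) + 1)
  -- Only the constant term of `f` survives next to the first-order coefficient of the exponent: the
  -- other coefficients of `f` tend to `0` by induction.
  rw [Finset.sum_eq_single (0, n)] at hsum
  · simp only [if_true, one_mul] at hsum
    rw [mul_div_cancel_right₀ _ hn1] at hsum
    refine hsum.congr fun β => ?_
    rw [div_eq_iff hn1, div_mul_eq_mul_div, coeff_succ_fSeries, Finset.sum_div]
    refine Finset.sum_congr rfl fun p _ => ?_
    ring
  · intro p hp hp'
    have : p.1 ≠ 0 := by
      rintro h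
      have := Finset.HasAntidiagonal.mem_antidiagonal.1 hp
      exact hp' (Prod.ext h (by omega))
    simp [this]
  · simp

lemma fCoeff_zero (L : ℂ) (β : ℝ) (i j : ℕ) : fCoeff L β i j 0 = 1 := by
  have := coeff_zero_fSeries L β i j
  simpa [fCoeff] using this

lemma fCoeff_neg (L : ℂ) (β : ℝ) (i j : ℕ) {l : ℤ} (hl : l < 0) : fCoeff L β i j l = 0 := by
  simp [fCoeff, not_le.2 hl]

lemma tendsto_fCoeff_div {L : ℂ} (hL : L.re < 0) (i j : ℕ) {l : ℤ} (hl : 0 < l) :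
    Tendsto (fun β : ℝ => fCoeff L β i j l / β) (𝓝[>] 0)
      (𝓝 (L * ((qPow L 1 - qPow L (-1)) * cCoeff L i j l))) := by
  have h := tendsto_fSeries_div hL i j l.toNat (by omega)
  have h' : ((l.toNat : ℕ) : ℤ) = l := by omega
  rw [h'] at h
  simpa [fCoeff, hl.le] using h

lemma tendsto_fCoeff {L : ℂ} (hL : L.re < 0) (i j : ℕ) (l : ℤ) :
    Tendsto (fun β : ℝ => fCoeff L β i j l) (𝓝[>] 0) (𝓝 (if l = 0 then 1 else 0)) := by
  rcases lt_trichotomy l 0 with h | h | h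
  · simp [fCoeff_neg _ _ _ _ h, h.ne]
  · subst h
    simp [fCoeff_zero]
  · have h0 : Tendsto (fun β : ℝ => (β : ℂ)) (𝓝[>] 0) (𝓝 0) :=
      tendsto_of_continuousAt (by fun_prop) (by simp)
    have h' := (tendsto_fCoeff_div hL i j h).mul h0
    rw [mul_zero] at h'
    rw [if_neg h.ne']
    refine h'.congr' ?_
    filter_upwards [eventually_Ioo] with β hβ
    have hb : (β : ℂ) ≠ 0 := by exact_mod_cast hβ.1.ne'
    field_simp

/-- Each coefficient of the exponent contains the factor `[min(0, j) m]_x = 0`. -/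
lemma fCoeff_zero_left (L : ℂ) (β : ℝ) (j : ℕ) (l : ℤ) :
    fCoeff L β 0 j l = if l = 0 then 1 else 0 := by
  have h : fExponent L β 0 j = 0 := by
    ext m
    simp [fExponent, xNum]
  have h1 : fSeries L β 0 j = 1 := by
    rw [fSeries, h]
    ext n
    rw [PowerSeries.coeff_subst' PowerSeries.HasSubst.zero', finsum_eq_single _ 0]
    · simp
    · intro k hk
      simp [hk]
  by_cases hl : 0 ≤ l
  · simp only [fCoeff, hl, if_true, h1, PowerSeries.coeff_one]
    congr 1
    simp
    omega
  · rw [fCoeff_neg _ _ _ _ (not_le.1 hl), if_neg (by omega)]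

/-! ### Weak convergence of vectors and operators. -/

section WeakConvergence

variable {V : Type*} [AddCommGroup V] [Module ℂ V]

/-- Weak convergence of vectors as `β → 0`, `β > 0`. -/
def WTendsto (u : ℝ → V) (u₀ : V) : Prop :=
  ∀ φ : Module.Dual ℂ V, Tendsto (fun β => φ (u β)) (𝓝[>] 0) (𝓝 (φ u₀))

namespace WTendsto

variable {u u' : ℝ → V} {u₀ u₀' : V}

lemma const (v : V) : WTendsto (fun _ => v) v := fun _ => tendsto_const_nhds

lemma congr' (h : WTendsto u u₀) (huu' : ∀ᶠ β in 𝓝[>] 0, u β = u' β) : WTendsto u' u₀ :=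
  fun φ => (h φ).congr' (huu'.mono fun β hβ => by rw [hβ])

lemma add (h : WTendsto u u₀) (h' : WTendsto u' u₀') :
    WTendsto (fun β => u β + u' β) (u₀ + u₀') := fun φ => by
  simpa using (h φ).add (h' φ)

lemma sub (h : WTendsto u u₀) (h' : WTendsto u' u₀') :
    WTendsto (fun β => u β - u' β) (u₀ - u₀') := fun φ => by
  simpa using (h φ).sub (h' φ)

lemma smul {c : ℝ → ℂ} {c₀ : ℂ} (hc : Tendsto c (𝓝[>] 0) (𝓝 c₀)) (h : WTendsto u u₀) :
    WTendsto (fun β => c β • u β) (c₀ • u₀) := fun φ => by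
  simpa using hc.mul (h φ)

lemma sum {ι : Type*} (s : Finset ι) {u : ι → ℝ → V} {u₀ : ι → V}
    (h : ∀ i ∈ s, WTendsto (u i) (u₀ i)) :
    WTendsto (fun β => ∑ i ∈ s, u i β) (∑ i ∈ s, u₀ i) := fun φ => by
  simpa using tendsto_finsetSum s fun i hi => h i hi φ

lemma unique (h : WTendsto u u₀) (h' : WTendsto u u₀') : u₀ = u₀' := by
  rw [← sub_eq_zero, ← Module.forall_dual_apply_eq_zero_iff ℂ]
  intro φ
  rw [map_sub, sub_eq_zero]
  exact tendsto_nhds_unique (h φ) (h' φ)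

lemma mem {W : Submodule ℂ V} (h : WTendsto u u₀) (hu : ∀ᶠ β in 𝓝[>] 0, u β ∈ W) :
    u₀ ∈ W := by
  by_contra hW
  obtain ⟨φ, hφ, hφW⟩ := Submodule.exists_le_ker_of_notMem hW
  refine hφ (tendsto_nhds_unique (h φ) ?_)
  refine tendsto_const_nhds.congr' (hu.mono fun β hβ => ?_)
  exact (hφW hβ).symm

/-- Weak limits need not respect composition in general. Confinement of `u β` to a fixed
finite-dimensional space reduces the claim to finitely many scalar coordinates times `A β` on fixed
basis vectors. -/
lemma apply {A : ℝ → Module.End ℂ V} {A₀ : Module.End ℂ V}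
    (hA : ∀ v, WTendsto (fun β => A β v) (A₀ v)) {W : Submodule ℂ V} [FiniteDimensional ℂ W]
    (h : WTendsto u u₀) (hu : ∀ᶠ β in 𝓝[>] 0, u β ∈ W) :
    WTendsto (fun β => A β (u β)) (A₀ u₀) := by
  let b := Module.finBasis ℂ W
  -- Weak convergence tests against functionals on all of `V`, so the coordinates of `W` are
  -- extended.
  choose c hc using fun k => (b.coord k).exists_extend
  have hexp : ∀ x ∈ W, x = ∑ k, c k x • (b k : V) := fun x hx => by
    have h1 := congrArg Subtype.val (b.sum_repr ⟨x, hx⟩)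
    have h2 : ∀ k, c k x = b.repr ⟨x, hx⟩ k := fun k => LinearMap.congr_fun (hc k) ⟨x, hx⟩
    rw [AddSubmonoidClass.coe_finsetSum] at h1
    simpa only [h2, Submodule.coe_smul] using h1.symm
  have key : WTendsto (fun β => ∑ k, c k (u β) • A β (b k)) (∑ k, c k u₀ • A₀ (b k)) :=
    sum _ fun k _ => smul (h (c k)) (hA _)
  have hu₀ : A₀ u₀ = ∑ k, c k u₀ • A₀ (b k) := by
    conv_lhs => rw [hexp u₀ (h.mem hu)]
    simp
  rw [hu₀]
  refine key.congr' (hu.mono fun β hβ => ?_)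
  conv_rhs => rw [hexp (u β) hβ]
  simp

end WTendsto

end WeakConvergence

/-! ### Bounds from the grading, uniform over all graded currents. -/

section Graded

variable {V : Type*} [AddCommGroup V] [Module ℂ V] {𝒱 : ℤ → Submodule ℂ V}

/-- The modes of the current `X` have degree `-m`. -/
def IsGradedCurrent (𝒱 : ℤ → Submodule ℂ V) (X : ℤ → Module.End ℂ V) : Prop :=
  ∀ (m d : ℤ) (v : V), v ∈ 𝒱 d → X m v ∈ 𝒱 (d - m)

/-- The bound depends on `v` alone, so one finite range of summation serves every `β`, every index
and the limit currents. -/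
lemma exists_annihilation_bound (h𝒱 : DirectSum.IsInternal 𝒱) (hbdd : ∃ d₀ : ℤ, ∀ d < d₀, 𝒱 d = ⊥)
    (v : V) : ∃ M : ℤ, ∀ X : ℤ → Module.End ℂ V, IsGradedCurrent 𝒱 X → ∀ n ≥ M, X n v = 0 := by
  have hv : v ∈ ⨆ d, 𝒱 d := h𝒱.submodule_iSup_eq_top ▸ Submodule.mem_top
  obtain ⟨d₀, hd₀⟩ := hbdd
  induction hv using Submodule.iSup_induction' with
  | mem d v hv =>
    refine ⟨d - d₀ + 1, fun X hX n hn => ?_⟩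
    have := hX n d v hv
    rwa [hd₀ _ (by omega), Submodule.mem_bot] at this
  | zero => exact ⟨0, fun X _ n _ => map_zero _⟩
  | add u v _ _ hu hv =>
    obtain ⟨M, hM⟩ := hu
    obtain ⟨M', hM'⟩ := hv
    refine ⟨max M M', fun X hX n hn => ?_⟩
    rw [map_add, hM X hX n (le_trans (le_max_left _ _) hn),
      hM' X hX n (le_trans (le_max_right _ _) hn), add_zero]

lemma exists_finiteDimensional_image (h𝒱 : DirectSum.IsInternal 𝒱)
    (hfin : ∀ d, FiniteDimensional ℂ (𝒱 d)) (v : V) (m : ℤ) :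
    ∃ W : Submodule ℂ V, FiniteDimensional ℂ W ∧
      ∀ X : ℤ → Module.End ℂ V, IsGradedCurrent 𝒱 X → X m v ∈ W := by
  have hv : v ∈ ⨆ d, 𝒱 d := h𝒱.submodule_iSup_eq_top ▸ Submodule.mem_top
  induction hv using Submodule.iSup_induction' with
  | mem d v hv => exact ⟨𝒱 (d - m), hfin _, fun X hX => hX m d v hv⟩
  | zero => exact ⟨⊥, inferInstance, fun X _ => by simp⟩
  | add u v _ _ hu hv =>
    obtain ⟨W, hW, h⟩ := hu
    obtain ⟨W', hW', h'⟩ := hv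
    refine ⟨W ⊔ W', inferInstance, fun X hX => ?_⟩
    rw [map_add]
    exact Submodule.add_mem_sup (h X hX) (h' X hX)

end Graded

/-! ### Convergence of the rational values and commutativity of the limit. -/

section ClassicalLimit

variable {V : Type*} [AddCommGroup V] [Module ℂ V]

lemma prodCoeff_eq_sum {S : ℤ → ℂ} (hS : ∀ l < 0, S l = 0) (X : ℤ → Module.End ℂ V)
    {Y : ℤ → Module.End ℂ V} {K : ℤ} (m n : ℤ) {v : V} (hY : ∀ l ≥ K, Y (n + l) v = 0) :
    prodCoeff S X Y m n v = ∑ l ∈ Finset.Ico 0 K, S l • X (m - l) (Y (n + l) v) := by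
  refine finsum_eq_sum_of_support_subset _ fun l hl => ?_
  rw [Finset.coe_Ico, Set.mem_Ico]
  by_contra h
  rw [not_and_or, not_le, not_lt] at h
  rcases h with h | h
  · exact hl (by simp [hS l h])
  · exact hl (by simp [hY l h])

lemma HasRationalValue.sub {A B : ℤ → V} {w : ℂ} {e e' : V} (hw : w ≠ 0)
    (h : HasRationalValue A w e) (h' : HasRationalValue B w e') :
    HasRationalValue (A - B) w (e - e') := by
  simpa [sub_eq_add_neg] using h.add hw (h'.smul (-1))

/-- The coefficient of `z₁ ^ (-m) z₂ ^ (-n)` in the `k`-th pair of delta function terms of the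
relation for `T_i` and `T_j`. -/
def poleTerm (L : ℂ) (β : ℝ) (T : ℕ → ℤ → Module.End ℂ V) (i j : ℕ) (m n : ℤ) (v : V)
    (k : ℕ) : V :=
  deltaCoeff (xPow L β (-(j : ℝ) + i - 2 * k)) (xPow L β k) m n
      (ratVal (dressedProduct L β T (i - k) (j + k) (m + n) v) (xPow L β ((j : ℝ) - i)))
    - deltaCoeff (xPow L β ((j : ℝ) - i + 2 * k)) (xPow L β (-k)) m n
      (ratVal (dressedProduct L β T (i - k) (j + k) (m + n) v) (xPow L β (-(j : ℝ) + i)))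

/-- The value at `z₂ / z₁ = w` of the coefficient of `z₁ ^ (-N)` in `X(z₁) Y(z₂) v`. -/
def currentProduct (X Y : ℤ → Module.End ℂ V) (N : ℤ) (v : V) (w : ℂ) : V :=
  evalAt w fun p => X (N + p) (Y (-p) v)

/-- The classical limit of `poleTerm`. -/
def classicalPoleTerm (L : ℂ) (T : ℕ → ℤ → Module.End ℂ V) (i j : ℕ) (m n : ℤ) (v : V)
    (k : ℕ) : V :=
  deltaCoeff (qPow L ((-(j : ℝ) + i) / 2 - k)) (qPow L ((k : ℝ) / 2)) m n
      (currentProduct (T (i - k)) (T (j + k)) (m + n) v (qPow L (((j : ℝ) - i) / 2)))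
    - deltaCoeff (qPow L (((j : ℝ) - i) / 2 + k)) (qPow L (-(k : ℝ) / 2)) m n
      (currentProduct (T (i - k)) (T (j + k)) (m + n) v (qPow L ((-(j : ℝ) + i) / 2)))

/-- The normalization of `poleTerm` in the relation, apart from `c(r, x)`. -/
def poleWeight (L : ℂ) (β : ℝ) (k : ℕ) : ℂ :=
  ∏ l ∈ Finset.Icc 1 (k - 1), Delta1 L β (xPow L β (2 * l + 1))

lemma tendsto_poleWeight {L : ℂ} (hL : L.re < 0) (k : ℕ) :
    Tendsto (fun β => poleWeight L β k) (𝓝[>] 0) (𝓝 1) := by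
  have := tendsto_finsetProd (Finset.Icc 1 (k - 1)) fun l hl =>
    tendsto_Delta1 hL (Finset.mem_Icc.1 hl).1
  simpa [poleWeight] using this

/-- Uniqueness of rational values replaces the existential witnesses, chosen anew for each `m`, `n`,
by `ratVal`, which depends on the modes only through `m + n`. This makes the delta terms geometric
along a line of constant `m + n`. -/
lemma IsWRepresentation.relation {L : ℂ} {β : ℝ} {𝒱 : ℤ → Submodule ℂ V}
    {T : ℕ → ℤ → Module.End ℂ V} (h : IsWRepresentation L β 𝒱 T) {i j : ℕ} (hi : 1 ≤ i)
    (hij : i ≤ j) (m n : ℤ) (v : V) :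
    prodCoeff (fCoeff L β i j) (T i) (T j) m n v - prodCoeff (fCoeff L β j i) (T j) (T i) n m v =
      cConst L β • ∑ k ∈ Finset.Icc 1 i, poleWeight L β k • poleTerm L β T i j m n v k := by
  obtain ⟨e₁, e₂, he, hrel⟩ := h.quadratic i j hi hij m n v
  rw [hrel]
  congr 1
  refine Finset.sum_congr rfl fun k hk => ?_
  rw [poleTerm, (he k hk).1.ratVal_eq (xPow_ne_zero _ _ _),
    (he k hk).2.ratVal_eq (xPow_ne_zero _ _ _), poleWeight]

lemma tendsto_xPow_zpow (L : ℂ) {y z : ℝ} (h : y / 2 = z) (n : ℤ) :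
    Tendsto (fun β => xPow L β y ^ n) (𝓝[>] 0) (𝓝 (qPow L z ^ n)) :=
  h ▸ (tendsto_xPow L y).zpow₀ n (.inl (qPow_ne_zero _ _))

lemma WTendsto.deltaCoeff {L : ℂ} {y y' z z' : ℝ} (h : y / 2 = z) (h' : y' / 2 = z') (m n : ℤ)
    {u : ℝ → V} {u₀ : V} (hu : WTendsto u u₀) :
    WTendsto (fun β => deltaCoeff (xPow L β y) (xPow L β y') m n (u β))
      (deltaCoeff (qPow L z) (qPow L z') m n u₀) :=
  .smul ((tendsto_xPow_zpow L h _).mul (tendsto_xPow_zpow L h' _)) hu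

/-- The value at `w = x ^ s` of the geometric series `∑_{p ≥ P} A ^ p t ^ (-N) w ^ p` with
`A = x ^ y` and `t = x ^ y'`. -/
def geomWeight (L : ℂ) (β y y' s : ℝ) (P N : ℤ) : ℂ :=
  (xPow L β y * xPow L β s) ^ P / (1 - xPow L β y * xPow L β s) * xPow L β y' ^ (-N)

lemma tendsto_geomWeight {L : ℂ} (hL : L.re < 0) {y s : ℝ} (hys : y + s ≠ 0) (y' : ℝ) (P N : ℤ) :
    Tendsto (fun β => geomWeight L β y y' s P N) (𝓝[>] 0)
      (𝓝 (qPow L ((y + s) / 2) ^ P / (1 - qPow L ((y + s) / 2)) * qPow L (y' / 2) ^ (-N))) := by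
  simp only [geomWeight, xPow_mul]
  exact ((tendsto_xPow_zpow L rfl P).div (tendsto_const_nhds.sub (tendsto_xPow L _))
    (sub_ne_zero.2 (qPow_ne_one hL (by positivity)).symm)).mul (tendsto_xPow_zpow L rfl _)

lemma hasRationalValue_deltaCoeff {L : ℂ} (hL : L.re < 0) {β : ℝ} (hβ : β < 1) {y s : ℝ}
    (hys : y + s ≠ 0) (y' : ℝ) (P N : ℤ) (e : V) :
    HasRationalValue
      (fun p => if P ≤ p then deltaCoeff (xPow L β y) (xPow L β y') (N + p) (-p) e else 0)
      (xPow L β s) (geomWeight L β y y' s P N • e) := by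
  have h := HasRationalValue.geometric P (xPow_ne_zero L β y) (w := xPow L β s)
    (by rw [xPow_mul]; exact xPow_ne_one hL hβ hys) (xPow L β y' ^ (-N) • e)
  simpa [deltaCoeff, geomWeight, mul_smul] using h

/-- The geometric tails have their poles at `x ^ (±(j - i + 2k))`, strictly outside the range of the
points `x ^ s`. -/
lemma neg_sub_ne_zero_of_abs_le {i j k : ℕ} (hk : 1 ≤ k) {s : ℝ} (hs : |s| ≤ (j : ℝ) - i) :
    -(j : ℝ) + i - 2 * k + s ≠ 0 ∧ (j : ℝ) - i + 2 * k + s ≠ 0 := by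
  have hk' : (1 : ℝ) ≤ k := by exact_mod_cast hk
  have := abs_le.1 hs
  constructor
  · exact (by linarith : -(j : ℝ) + i - 2 * k + s < 0).ne
  · exact (by linarith : 0 < (j : ℝ) - i + 2 * k + s).ne'

/-- The value at `w = x ^ s` of `∑_{p ≥ P} w ^ p` times the `poleTerm` of index `(N + p, -p)`. -/
def poleTail (L : ℂ) (β : ℝ) (T : ℕ → ℤ → Module.End ℂ V) (i j : ℕ) (N P : ℤ) (v : V) (s : ℝ)
    (k : ℕ) : V :=
  geomWeight L β (-(j : ℝ) + i - 2 * k) k s P N •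
      ratVal (dressedProduct L β T (i - k) (j + k) N v) (xPow L β ((j : ℝ) - i))
    - geomWeight L β ((j : ℝ) - i + 2 * k) (-k) s P N •
      ratVal (dressedProduct L β T (i - k) (j + k) N v) (xPow L β (-(j : ℝ) + i))

lemma hasRationalValue_poleTail {L : ℂ} (hL : L.re < 0) {β : ℝ} (hβ : β < 1)
    (T : ℕ → ℤ → Module.End ℂ V) {i j : ℕ} (N P : ℤ) (v : V) {s : ℝ}
    (hs : |s| ≤ (j : ℝ) - i) {k : ℕ} (hk : 1 ≤ k) :
    HasRationalValue (fun p => if P ≤ p then poleTerm L β T i j (N + p) (-p) v k else 0)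
      (xPow L β s) (poleTail L β T i j N P v s k) := by
  obtain ⟨h1, h2⟩ := neg_sub_ne_zero_of_abs_le hk hs
  convert (hasRationalValue_deltaCoeff hL hβ h1 k P N
    (ratVal (dressedProduct L β T (i - k) (j + k) N v) (xPow L β ((j : ℝ) - i)))).sub
    (xPow_ne_zero _ _ _) (hasRationalValue_deltaCoeff hL hβ h2 (-k) P N
    (ratVal (dressedProduct L β T (i - k) (j + k) N v) (xPow L β (-(j : ℝ) + i)))) using 1
  · funext p
    by_cases hp : P ≤ p
    · simp [hp, poleTerm]
    · simp [hp]
  · rfl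

/-- The operators `T β` form representations on a graded space with bounded below grading and
finite dimensional components, and converge weakly to `T₀` as `β → 0`. -/
structure IsClassicalLimit (L : ℂ) (𝒱 : ℤ → Submodule ℂ V) (T : ℝ → ℕ → ℤ → Module.End ℂ V)
    (T₀ : ℕ → ℤ → Module.End ℂ V) : Prop where
  internal : DirectSum.IsInternal 𝒱
  finite : ∀ d, FiniteDimensional ℂ (𝒱 d)
  bounded : ∃ d₀ : ℤ, ∀ d < d₀, 𝒱 d = ⊥
  re_neg : L.re < 0
  rep : ∀ᶠ β in 𝓝[>] (0 : ℝ), IsWRepresentation L β 𝒱 (T β)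
  tendsto : ∀ (i : ℕ) (m : ℤ) (v : V), WTendsto (fun β => T β i m v) (T₀ i m v)

lemma IsWRepresentation.graded {L : ℂ} {β : ℝ} {𝒱 : ℤ → Submodule ℂ V}
    {T : ℕ → ℤ → Module.End ℂ V} (h : IsWRepresentation L β 𝒱 T) (i : ℕ) :
    IsGradedCurrent 𝒱 (T i) := h.degree i

/-- The values of the dressed products of `T_a` with `T_b`, `b ≥ a`, at the points
`x ^ s`, `|s| ≤ b - a`, converge to the values of the classical products. -/
def ValuesConverge (L : ℂ) (T : ℝ → ℕ → ℤ → Module.End ℂ V) (T₀ : ℕ → ℤ → Module.End ℂ V)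
    (a : ℕ) : Prop :=
  ∀ b : ℕ, a ≤ b → ∀ (N : ℤ) (v : V) (s : ℝ), |s| ≤ (b : ℝ) - a →
    WTendsto (fun β => ratVal (dressedProduct L β (T β) a b N v) (xPow L β s))
      (currentProduct (T₀ a) (T₀ b) N v (qPow L (s / 2)))

namespace IsClassicalLimit

variable {L : ℂ} {𝒱 : ℤ → Submodule ℂ V} {T : ℝ → ℕ → ℤ → Module.End ℂ V}
  {T₀ : ℕ → ℤ → Module.End ℂ V}

lemma graded (h : IsClassicalLimit L 𝒱 T T₀) (i : ℕ) : IsGradedCurrent 𝒱 (T₀ i) :=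
  fun m d v hv => (h.tendsto i m v).mem (h.rep.mono fun _ hβ => hβ.degree i m d v hv)

lemma tendsto_mul (h : IsClassicalLimit L 𝒱 T T₀) (i j : ℕ) (m n : ℤ) (v : V) :
    WTendsto (fun β => T β i m (T β j n v)) (T₀ i m (T₀ j n v)) := by
  obtain ⟨W, hW, hWT⟩ := exists_finiteDimensional_image h.internal h.finite v n
  exact WTendsto.apply (h.tendsto i m) (W := W) (h.tendsto j n v)
    (h.rep.mono fun β hβ => hWT _ (hβ.graded j))

lemma zero (h : IsClassicalLimit L 𝒱 T T₀) (m : ℤ) : T₀ 0 m = if m = 0 then 1 else 0 := by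
  ext v
  refine (h.tendsto 0 m v).unique ((WTendsto.const _).congr' (h.rep.mono fun β hβ => ?_))
  rw [hβ.zero]

lemma tendsto_prodCoeff (h : IsClassicalLimit L 𝒱 T T₀) (a b : ℕ) (m n : ℤ) (v : V) :
    WTendsto (fun β => prodCoeff (fCoeff L β a b) (T β a) (T β b) m n v)
      (T₀ a m (T₀ b n v)) := by
  obtain ⟨M, hM⟩ := exists_annihilation_bound h.internal h.bounded v
  have h0 : ∑ l ∈ Finset.Ico 0 (max 1 (M - n)),
      (if l = 0 then (1 : ℂ) else 0) • T₀ a (m - l) (T₀ b (n + l) v) = T₀ a m (T₀ b n v) := by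
    rw [Finset.sum_eq_single 0]
    · simp
    · intro l _ hl
      simp [hl]
    · intro hl
      exact absurd (Finset.mem_Ico.2 ⟨le_rfl, by simp⟩) hl
  rw [← h0]
  refine (WTendsto.sum _ fun l _ => WTendsto.smul (tendsto_fCoeff h.re_neg a b l)
    (h.tendsto_mul a b (m - l) (n + l) v)).congr' (h.rep.mono fun β hβ => ?_)
  refine (prodCoeff_eq_sum (fun l hl => fCoeff_neg _ _ _ _ hl) _ m n fun l hl => ?_).symm
  exact hM _ (hβ.graded b) _ (by have := le_max_right 1 (M - n); omega)

lemma abs_le_of_mem_Icc {i j k : ℕ} (hij : i ≤ j) (hk : k ∈ Finset.Icc 1 i) :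
    |(j : ℝ) - i| ≤ ((j + k : ℕ) : ℝ) - (i - k : ℕ) ∧
      |-(j : ℝ) + i| ≤ ((j + k : ℕ) : ℝ) - (i - k : ℕ) := by
  have h1 : (i : ℝ) ≤ j := by exact_mod_cast hij
  have hb : |(j : ℝ) - i| ≤ ((j + k : ℕ) : ℝ) - (i - k : ℕ) := by
    rw [abs_of_nonneg (by linarith)]
    push_cast [Nat.cast_sub (Finset.mem_Icc.1 hk).2]
    have : (0 : ℝ) ≤ k := k.cast_nonneg
    linarith
  exact ⟨hb, by rwa [show -(j : ℝ) + i = -(j - i) by ring, abs_neg]⟩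

lemma tendsto_poleTerm {i j : ℕ} (hij : i ≤ j)
    (hv : ∀ a < i, ValuesConverge L T T₀ a) (m n : ℤ) (v : V) {k : ℕ}
    (hk : k ∈ Finset.Icc 1 i) :
    WTendsto (fun β => poleTerm L β (T β) i j m n v k) (classicalPoleTerm L T₀ i j m n v k) := by
  obtain ⟨hk1, hki⟩ := Finset.mem_Icc.1 hk
  obtain ⟨hb, hb'⟩ := abs_le_of_mem_Icc hij hk
  have hlt : i - k < i := by omega
  exact .sub (.deltaCoeff (by ring) rfl m n (hv _ hlt (j + k) (by omega) (m + n) v _ hb))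
    (.deltaCoeff (by ring) rfl m n (hv _ hlt (j + k) (by omega) (m + n) v _ hb'))

lemma tendsto_poleTerms (h : IsClassicalLimit L 𝒱 T T₀) {i j : ℕ} (hij : i ≤ j)
    (hv : ∀ a < i, ValuesConverge L T T₀ a) (m n : ℤ) (v : V) :
    WTendsto
      (fun β => ∑ k ∈ Finset.Icc 1 i, poleWeight L β k • poleTerm L β (T β) i j m n v k)
      (∑ k ∈ Finset.Icc 1 i, classicalPoleTerm L T₀ i j m n v k) := by
  refine .sum _ fun k hk => ?_
  rw [← one_smul ℂ (classicalPoleTerm L T₀ i j m n v k)]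
  exact .smul (tendsto_poleWeight h.re_neg k) (tendsto_poleTerm hij hv m n v hk)

lemma apply_comm_of_valuesConverge (h : IsClassicalLimit L 𝒱 T T₀) {i j : ℕ} (hi : 1 ≤ i)
    (hij : i ≤ j) (hv : ∀ a < i, ValuesConverge L T T₀ a) (m n : ℤ) (v : V) :
    T₀ i m (T₀ j n v) = T₀ j n (T₀ i m v) := by
  rw [← sub_eq_zero]
  refine ((h.tendsto_prodCoeff i j m n v).sub (h.tendsto_prodCoeff j i n m v)).unique ?_
  rw [← zero_smul ℂ (∑ k ∈ Finset.Icc 1 i, classicalPoleTerm L T₀ i j m n v k)]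
  exact (WTendsto.smul (tendsto_cConst h.re_neg) (h.tendsto_poleTerms hij hv m n v)).congr'
    (h.rep.mono fun β hβ => (hβ.relation hi hij m n v).symm)

lemma valuesConverge_zero (h : IsClassicalLimit L 𝒱 T T₀) :
    ValuesConverge L T T₀ 0 := by
  intro b _ N v s _
  have hval : ∀ (w : ℂ) (X Y : ℤ → Module.End ℂ V), (∀ m, X m = if m = 0 then 1 else 0) →
      (Function.support fun p : ℤ => X (N + p) (Y (-p) v)).Finite ∧
        currentProduct X Y N v w = w ^ (-N) • Y N v := by
    intro w X Y hX
    have h0 : ∀ p, p ≠ -N → X (N + p) (Y (-p) v) = 0 := fun p hp => by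
      rw [hX, if_neg (by omega)]
      rfl
    refine ⟨(Set.finite_singleton (-N)).subset fun p hp => ?_, ?_⟩
    · by_contra hp'
      exact hp (h0 p hp')
    · rw [currentProduct, evalAt, finsum_eq_single _ (-N) fun p hp => by rw [h0 p hp, smul_zero]]
      simp [hX]
  rw [(hval _ _ _ h.zero).2]
  refine (WTendsto.smul (tendsto_xPow_zpow L rfl (-N)) (h.tendsto b N v)).congr'
    (h.rep.mono fun β hβ => ?_)
  -- Since `f_{0,b} = 1` and `T_0 = 1`, the dressed product is the single monomial at `p = -N`.
  have hd : dressedProduct L β (T β) 0 b N v = fun p => T β 0 (N + p) (T β b (-p) v) := by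
    funext p
    rw [dressedProduct, prodCoeff, finsum_eq_single _ 0 fun l hl => by
      rw [fCoeff_zero_left, if_neg hl, zero_smul]]
    simp [fCoeff_zero]
  rw [hd, (HasRationalValue.of_finite (hval 0 _ _ hβ.zero).1 _).ratVal_eq (xPow_ne_zero _ _ _)]
  exact (hval _ _ _ hβ.zero).2.symm

lemma tendsto_smul_poleTails (h : IsClassicalLimit L 𝒱 T T₀) {i j : ℕ} (hij : i ≤ j)
    (hv : ∀ a < i, ValuesConverge L T T₀ a) (N P : ℤ) (v : V) {s : ℝ}
    (hs : |s| ≤ (j : ℝ) - i) :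
    WTendsto (fun β => cConst L β •
      ∑ k ∈ Finset.Icc 1 i, poleWeight L β k • poleTail L β (T β) i j N P v s k) 0 := by
  -- Only the existence of a limit is needed, because the prefactor `c(r, x)` tends to `0`.
  have key : ∀ k, ∃ u, k ∈ Finset.Icc 1 i →
      WTendsto (fun β => poleTail L β (T β) i j N P v s k) u := fun k => by
    by_cases hk : k ∈ Finset.Icc 1 i
    · obtain ⟨hk1, hki⟩ := Finset.mem_Icc.1 hk
      obtain ⟨hb, hb'⟩ := abs_le_of_mem_Icc hij hk
      obtain ⟨h1, h2⟩ := neg_sub_ne_zero_of_abs_le hk1 hs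
      have hlt : i - k < i := by omega
      exact ⟨_, fun _ => .sub
        (.smul (tendsto_geomWeight h.re_neg h1 _ P N) (hv _ hlt (j + k) (by omega) N v _ hb))
        (.smul (tendsto_geomWeight h.re_neg h2 _ P N) (hv _ hlt (j + k) (by omega) N v _ hb'))⟩
    · exact ⟨0, fun hk' => absurd hk' hk⟩
  choose u hu using key
  have := WTendsto.smul (tendsto_cConst h.re_neg) (.sum (Finset.Icc 1 i) fun k hk =>
    .smul (tendsto_poleWeight h.re_neg k) (hu k hk))
  rwa [zero_smul] at this

/-- For a general index the dressed product is a Laurent polynomial plus geometric series, whose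
residues carry the factor `c(r, x)` and vanish in the limit. -/
lemma valuesConverge_step (h : IsClassicalLimit L 𝒱 T T₀) {i : ℕ} (hi : 1 ≤ i)
    (hv : ∀ a < i, ValuesConverge L T T₀ a) : ValuesConverge L T T₀ i := by
  intro j hij N v s hs
  obtain ⟨M, hM⟩ := exists_annihilation_bound h.internal h.bounded v
  -- For `p ≥ P` every mode `T_i[N + p + l]`, `l ≥ 0`, kills `v`, so the opposite product vanishes;
  -- for `p < -M` the modes `T_j[-p + l]` do.
  obtain ⟨P, hP⟩ : ∃ P, P = M - N := ⟨_, rfl⟩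
  have hlimit : currentProduct (T₀ i) (T₀ j) N v (qPow L (s / 2)) =
      ∑ p ∈ Finset.Ico (-M) P, qPow L (s / 2) ^ p • T₀ i (N + p) (T₀ j (-p) v) := by
    refine finsum_eq_sum_of_support_subset _ fun p hp => ?_
    rw [Finset.coe_Ico, Set.mem_Ico]
    by_contra hp'
    rw [not_and_or, not_le, not_lt] at hp'
    refine hp ?_
    rcases hp' with hp' | hp'
    · simp only
      rw [hM _ (h.graded j) _ (by omega), map_zero, smul_zero]
    · simp only
      -- Commutativity at this stage uses only the values for indices below `i`, so the induction is
      -- not circular.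
      rw [h.apply_comm_of_valuesConverge hi hij hv, hM _ (h.graded i) _ (by omega), map_zero,
        smul_zero]
  have hlim := (WTendsto.sum (Finset.Ico (-M) P) fun p _ =>
    WTendsto.smul (tendsto_xPow_zpow L (y := s) rfl p) (h.tendsto_prodCoeff i j (N + p) (-p) v)).add
      (h.tendsto_smul_poleTails hij hv N P v hs)
  rw [add_zero, ← hlimit] at hlim
  refine hlim.congr' ?_
  filter_upwards [h.rep, eventually_Ioo] with β hβ hβ1
  set F := dressedProduct L β (T β) i j N v with hF
  have hw := xPow_ne_zero L β s
  have hlow : ∀ p < -M, F p = 0 := fun p hp => by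
    rw [hF, dressedProduct, prodCoeff_eq_sum (K := 0) (fun l hl => fCoeff_neg _ _ _ _ hl) _ _ _
      fun l hl => hM _ (hβ.graded j) _ (by omega)]
    simp
  have hhigh : ∀ p, P ≤ p → F p = cConst L β •
      ∑ k ∈ Finset.Icc 1 i, poleWeight L β k • poleTerm L β (T β) i j (N + p) (-p) v k :=
    fun p hp => by
      rw [← hβ.relation hi hij, prodCoeff_eq_sum (X := T β j) (K := 0)
        (fun l hl => fCoeff_neg _ _ _ _ hl) _ _ fun l hl => hM _ (hβ.graded i) _ (by omega)]
      simp [hF, dressedProduct]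
  let B : ℤ → V := fun p => if P ≤ p then 0 else F p
  have hB : Function.support B ⊆ Finset.Ico (-M) P := fun p hp => by
    rw [Finset.coe_Ico, Set.mem_Ico]
    by_contra hp'
    rw [not_and_or, not_le, not_lt] at hp'
    rcases hp' with hp' | hp'
    · exact hp (by simp [B, hlow p hp'])
    · exact hp (by simp [B, hp'])
  have hdecomp : F = B + cConst L β • ∑ k ∈ Finset.Icc 1 i, poleWeight L β k • fun p =>
      if P ≤ p then poleTerm L β (T β) i j (N + p) (-p) v k else 0 := by
    funext p
    by_cases hp : P ≤ p
    · simp [B, hp, hhigh p hp]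
    · simp [B, hp]
  have hval := (HasRationalValue.of_finite ((Finset.finite_toSet _).subset hB) _).add hw
    ((HasRationalValue.sum (Finset.Icc 1 i) hw fun k hk =>
      (hasRationalValue_poleTail h.re_neg hβ1.2 (T β) N P v hs
        (Finset.mem_Icc.1 hk).1).smul (poleWeight L β k)).smul (cConst L β))
  rw [← hdecomp] at hval
  rw [hval.ratVal_eq hw]
  congr 1
  rw [evalAt, finsum_eq_sum_of_support_subset]
  · refine Finset.sum_congr rfl fun p hp => ?_
    have := (Finset.mem_Ico.1 hp).2
    simp [B, not_le.2 this, hF, dressedProduct]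
  · exact fun p hp => hB fun h0 => hp (by simp only [h0, smul_zero])

lemma valuesConverge (h : IsClassicalLimit L 𝒱 T T₀) (i : ℕ) : ValuesConverge L T T₀ i := by
  induction i using Nat.strong_induction_on with
  | _ i ih =>
  rcases Nat.eq_zero_or_pos i with rfl | hi
  · exact h.valuesConverge_zero
  · exact h.valuesConverge_step hi ih

lemma commute (h : IsClassicalLimit L 𝒱 T T₀) (i j : ℕ) (m n : ℤ) :
    Commute (T₀ i m) (T₀ j n) := by
  have h0 : ∀ (j : ℕ) (m n : ℤ), Commute (T₀ 0 m) (T₀ j n) := fun j m n => by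
    rw [h.zero]
    split_ifs
    exacts [Commute.one_left _, Commute.zero_left _]
  have h1 : ∀ (i j : ℕ) (m n : ℤ), i ≤ j → Commute (T₀ i m) (T₀ j n) := fun i j m n hij => by
    rcases Nat.eq_zero_or_pos i with rfl | hi
    · exact h0 j m n
    · ext v
      exact h.apply_comm_of_valuesConverge hi hij (fun a _ => h.valuesConverge a) m n v
  rcases le_total i j with hij | hij
  exacts [h1 i j m n hij, (h1 j i n m hij).symm]

lemma finite_support (h : IsClassicalLimit L 𝒱 T T₀) (i j : ℕ) (m n : ℤ) (v : V) :
    (Function.support fun l : ℤ => T₀ i (m - l) (T₀ j (n + l) v)).Finite := by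
  obtain ⟨M, hM⟩ := exists_annihilation_bound h.internal h.bounded v
  refine (Set.finite_Ioo (m - M) (M - n)).subset fun l hl => ⟨?_, ?_⟩ <;> by_contra hl'
  · refine hl ?_
    have := LinearMap.congr_fun (h.commute i j (m - l) (n + l)).eq v
    simp only [Module.End.mul_apply] at this
    simp only [this]
    rw [hM _ (h.graded i) _ (by omega), map_zero]
  · refine hl ?_
    simp only
    rw [hM _ (h.graded j) _ (by omega), map_zero]

end IsClassicalLimit

end ClassicalLimit

/-! ### The Poisson bracket. -/

section Bracket

variable {V : Type*} [AddCommGroup V] [Module ℂ V]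

lemma deltaCoeff_currentProduct (L : ℂ) {y y' y'' z : ℝ} (hy'' : y'' = -y') (hz : z = -y - 2 * y')
    (X Y : ℤ → Module.End ℂ V) (m n : ℤ) (v : V) :
    deltaCoeff (qPow L y) (qPow L y') m n (currentProduct X Y (m + n) v (qPow L z)) =
      prodCoeff (fun l => qPow L y ^ l) (rescale (qPow L y') X) (rescale (qPow L y'') Y) m n v := by
  subst hy'' hz
  -- The substitution `p = -n - l` matches the sum over powers of `z₂ / z₁` with the sum over
  -- delta-function modes.
  rw [deltaCoeff, currentProduct, evalAt, smul_finsum, prodCoeff,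
    ← finsum_comp_equiv (Equiv.subLeft (-n))]
  refine finsum_congr fun l => ?_
  simp only [Equiv.subLeft_apply, rescale, LinearMap.smul_apply, map_smul, smul_smul]
  rw [show m + n + (-n - l) = m - l by ring, show -(-n - l) = n + l by ring]
  congr 1
  simp only [qPow_zpow, ← qPow_add]
  congr 1
  push_cast
  ring

lemma classicalPoleTerm_eq (L : ℂ) (T : ℕ → ℤ → Module.End ℂ V) (i j : ℕ) (m n : ℤ) (v : V)
    (k : ℕ) :
    classicalPoleTerm L T i j m n v k =
      prodCoeff (fun l => qPow L ((-(j : ℝ) + i) / 2 - k) ^ l)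
        (rescale (qPow L ((k : ℝ) / 2)) (T (i - k)))
        (rescale (qPow L (-(k : ℝ) / 2)) (T (j + k))) m n v
      - prodCoeff (fun l => qPow L (((j : ℝ) - i) / 2 + k) ^ l)
        (rescale (qPow L (-(k : ℝ) / 2)) (T (i - k)))
        (rescale (qPow L ((k : ℝ) / 2)) (T (j + k))) m n v := by
  rw [classicalPoleTerm, deltaCoeff_currentProduct L (y'' := -(k : ℝ) / 2) (by ring) (by ring),
    deltaCoeff_currentProduct L (y'' := (k : ℝ) / 2) (by ring) (by ring)]

lemma prodCoeff_fCoeff (L : ℂ) (β : ℝ) (i j : ℕ) (X : ℤ → Module.End ℂ V)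
    {Y : ℤ → Module.End ℂ V} {K : ℤ} (hK : 1 ≤ K) (m n : ℤ) {v : V}
    (hY : ∀ l ≥ K, Y (n + l) v = 0) :
    prodCoeff (fCoeff L β i j) X Y m n v = X m (Y n v) +
      ∑ l ∈ Finset.Ico 1 K, fCoeff L β i j l • X (m - l) (Y (n + l) v) := by
  have h : Finset.Ico 0 K = insert 0 (Finset.Ico 1 K) := by
    ext l
    simp only [Finset.mem_insert, Finset.mem_Ico]
    omega
  rw [prodCoeff_eq_sum (fun l hl => fCoeff_neg _ _ _ _ hl) X m n hY, h,
    Finset.sum_insert (by simp), fCoeff_zero]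
  simp

namespace IsClassicalLimit

variable {L : ℂ} {𝒱 : ℤ → Submodule ℂ V} {T : ℝ → ℕ → ℤ → Module.End ℂ V}
  {T₀ : ℕ → ℤ → Module.End ℂ V}

/-- The negative modes of `C_{i,j}` become the second sum by oddness and by commuting the operators;
the zero mode vanishes. -/
lemma prodCoeff_cCoeff (h : IsClassicalLimit L 𝒱 T T₀) (i j : ℕ) {K m n : ℤ} {v : V}
    (hi : ∀ l ≥ K, T₀ i (m + l) v = 0) (hj : ∀ l ≥ K, T₀ j (n + l) v = 0) :
    prodCoeff (cCoeff L i j) (T₀ i) (T₀ j) m n v =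
      ∑ l ∈ Finset.Ico 1 K, cCoeff L i j l • T₀ i (m - l) (T₀ j (n + l) v)
        - ∑ l ∈ Finset.Ico 1 K, cCoeff L j i l • T₀ j (n - l) (T₀ i (m + l) v) := by
  have hcomm : ∀ a b, T₀ i a (T₀ j b v) = T₀ j b (T₀ i a v) := fun a b =>
    LinearMap.congr_fun (h.commute i j a b).eq v
  have hdisj : Disjoint (Finset.Ico 1 K) ((Finset.Ico 1 K).image Neg.neg) := by
    rw [Finset.disjoint_left]
    intro l hl hl'
    obtain ⟨l', hl'', rfl⟩ := Finset.mem_image.1 hl'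
    rw [Finset.mem_Ico] at hl hl''
    omega
  rw [prodCoeff, finsum_eq_sum_of_support_subset (s :=
    Finset.Ico 1 K ∪ (Finset.Ico 1 K).image Neg.neg), Finset.sum_union hdisj,
    Finset.sum_image fun a _ b _ hab => neg_injective hab, sub_eq_add_neg, ← Finset.sum_neg_distrib]
  · congr 1
    refine Finset.sum_congr rfl fun l _ => ?_
    rw [cCoeff_neg, cCoeff_comm, hcomm, neg_smul, sub_neg_eq_add, ← sub_eq_add_neg]
  · intro l hl
    by_contra hl'
    refine hl ?_
    simp only [Finset.coe_union, Finset.coe_image, Set.mem_union, Finset.mem_coe, Set.mem_image,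
      Finset.mem_Ico, not_or, not_exists, not_and] at hl'
    have h2 : ¬ (1 ≤ -l ∧ -l < K) := fun h2 => hl'.2 (-l) h2 (neg_neg l)
    rcases lt_trichotomy l 0 with h0 | rfl | h0
    · have := hi (-l) (by omega)
      rw [← sub_eq_add_neg] at this
      simp only [hcomm, this, map_zero, smul_zero]
    · simp [cCoeff_zero]
    · simp only [hj l (by omega), map_zero, smul_zero]

lemma tendsto_fCoeff_terms (h : IsClassicalLimit L 𝒱 T T₀) (i j : ℕ) (m n K : ℤ) (v : V) :
    WTendsto (fun β => ∑ l ∈ Finset.Ico 1 K, (1 / ((β : ℂ) * L)) •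
        fCoeff L β i j l • T β i (m - l) (T β j (n + l) v))
      ((qPow L 1 - qPow L (-1)) •
        ∑ l ∈ Finset.Ico 1 K, cCoeff L i j l • T₀ i (m - l) (T₀ j (n + l) v)) := by
  have hL : L ≠ 0 := by
    rintro rfl
    exact h.re_neg.ne rfl
  rw [Finset.smul_sum]
  refine .sum _ fun l hl => ?_
  simp only [smul_smul]
  refine .smul ?_ (h.tendsto_mul i j _ _ v)
  have hf := (tendsto_fCoeff_div h.re_neg i j (show 0 < l by
    have := (Finset.mem_Ico.1 hl).1
    omega)).div_const L
  rw [mul_div_cancel_left₀ _ hL] at hf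
  refine hf.congr fun β => ?_
  rw [div_div, one_div_mul_eq_div]

lemma hasPoissonBracket (h : IsClassicalLimit L 𝒱 T T₀) {i j : ℕ} (hi : 1 ≤ i) (hij : i ≤ j)
    (m n : ℤ) (v : V) :
    WTendsto (fun β => -((1 / ((β : ℂ) * L)) • (T β i m (T β j n v) - T β j n (T β i m v))))
      ((qPow L 1 - qPow L (-1)) • prodCoeff (cCoeff L i j) (T₀ i) (T₀ j) m n v
        - ∑ k ∈ Finset.Icc 1 i, classicalPoleTerm L T₀ i j m n v k) := by
  have hL : L ≠ 0 := by
    rintro rfl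
    exact h.re_neg.ne rfl
  obtain ⟨M, hM⟩ := exists_annihilation_bound h.internal h.bounded v
  obtain ⟨K, hK, hKm, hKn⟩ : ∃ K : ℤ, 1 ≤ K ∧ M - m ≤ K ∧ M - n ≤ K :=
    ⟨max 1 (max (M - m) (M - n)), by simp, by simp, by simp⟩
  have hc : Tendsto (fun β : ℝ => cConst L β / (β * L)) (𝓝[>] 0) (𝓝 1) := by
    have := (tendsto_cConst_div h.re_neg).div_const L
    rw [div_self hL] at this
    exact this.congr fun β => div_div _ _ _
  have hlim := ((h.tendsto_fCoeff_terms i j m n K v).sub (h.tendsto_fCoeff_terms j i n m K v)).sub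
    (.smul hc (h.tendsto_poleTerms hij (fun a _ => h.valuesConverge a) m n v))
  rw [one_smul, ← smul_sub, ← h.prodCoeff_cCoeff i j (fun l hl => hM _ (h.graded i) _ (by omega))
    fun l hl => hM _ (h.graded j) _ (by omega)] at hlim
  refine hlim.congr' (h.rep.mono fun β hβ => ?_)
  -- Splitting off the constant terms `1` of both structure functions isolates the commutator, which
  -- is then solved for with the sign of the bracket.
  have hrel := hβ.relation hi hij m n v
  rw [prodCoeff_fCoeff L β i j _ hK m n fun l hl => hM _ (hβ.graded j) _ (by omega),
    prodCoeff_fCoeff L β j i _ hK n m fun l hl => hM _ (hβ.graded i) _ (by omega)] at hrel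
  rw [div_eq_mul_one_div (cConst L β), mul_comm (cConst L β), mul_smul, ← hrel, ← Finset.smul_sum, ← Finset.smul_sum,
    ← smul_sub, ← smul_sub, ← smul_neg]
  congr 1
  abel

end IsClassicalLimit

end Bracket

end

end QPoissonSL21

theorem mainTheorem6 {V : Type*} [AddCommGroup V] [Module ℂ V]
    (𝒱 : ℤ → Submodule ℂ V) (h𝒱 : DirectSum.IsInternal 𝒱)
    (hfin : ∀ d, FiniteDimensional ℂ (𝒱 d)) (hbdd : ∃ d₀ : ℤ, ∀ d < d₀, 𝒱 d = ⊥)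
    (L : ℂ) (hL : L.re < 0)
    (T : ℝ → ℕ → ℤ → Module.End ℂ V) (TPB : ℕ → ℤ → Module.End ℂ V)
    (hT : ∀ᶠ β in 𝓝[>] (0 : ℝ), QPoissonSL21.IsWRepresentation L β 𝒱 (T β))
    (hlim : ∀ (i : ℕ) (m : ℤ),
      QPoissonSL21.MatrixTendsto (fun β v => T β i m v) (fun v => TPB i m v)) :
    (∀ m : ℤ, TPB 0 m = if m = 0 then 1 else 0) ∧
    (∀ (i j : ℕ) (m n : ℤ), Commute (TPB i m) (TPB j n)) ∧
    (∀ (i j : ℕ) (m n : ℤ) (v : V),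
      (Function.support fun l : ℤ => TPB i (m - l) (TPB j (n + l) v)).Finite) ∧
    ∀ i j : ℕ, 1 ≤ i → i ≤ j → ∀ m n : ℤ,
      QPoissonSL21.HasPoissonBracket L T i j m n fun v =>
        (QPoissonSL21.qPow L 1 - QPoissonSL21.qPow L (-1)) •
            QPoissonSL21.prodCoeff (QPoissonSL21.cCoeff L i j) (TPB i) (TPB j) m n v
          - ∑ k ∈ Finset.Icc 1 i,
              QPoissonSL21.prodCoeff
                (fun l => QPoissonSL21.qPow L ((-(j : ℝ) + i) / 2 - k) ^ l)
                (QPoissonSL21.rescale (QPoissonSL21.qPow L ((k : ℝ) / 2)) (TPB (i - k)))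
                (QPoissonSL21.rescale (QPoissonSL21.qPow L (-(k : ℝ) / 2)) (TPB (j + k))) m n v
          + ∑ k ∈ Finset.Icc 1 i,
              QPoissonSL21.prodCoeff
                (fun l => QPoissonSL21.qPow L (((j : ℝ) - i) / 2 + k) ^ l)
                (QPoissonSL21.rescale (QPoissonSL21.qPow L (-(k : ℝ) / 2)) (TPB (i - k)))
                (QPoissonSL21.rescale (QPoissonSL21.qPow L ((k : ℝ) / 2)) (TPB (j + k))) m n v := by
  have h : QPoissonSL21.IsClassicalLimit L 𝒱 T TPB :=
    ⟨h𝒱, hfin, hbdd, hL, hT, fun i m v φ => hlim i m φ v⟩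
  refine ⟨h.zero, h.commute, h.finite_support, fun i j hi hij m n φ v => ?_⟩
  have hb := h.hasPoissonBracket hi hij m n v φ
  simp only [QPoissonSL21.classicalPoleTerm_eq, Finset.sum_sub_distrib, ← sub_add] at hb
  exact hb
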